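/- \textsc{Critical Node Cut} is the following problem: given a finite simple undirected graph $G$ and integers $k, x \ge 0$, decide whether there is a set $C \subseteq V(G)$ of at most $k$ vertices such that $G - C$ has at most $x$ connected pairs, where a connected pair of $G-C$ is an ordered pair $(u,v)$ of distinct vertices that lie in the same connected component of $G-C$. A parameterized problem $A$ is \emph{reducible} to a parameterized problem $B$ if there are computable functions $f, g\colon \mathbb{N} \to \mathbb{N}$, a constant $c$, and an algorithm that maps every $(I,k)$ in time at most $f(k)\cdot |I|^{c}$ to some $(I',k')$ with $k' \le g(k)$ such that $(I,k) \in A$ if and only if $(I',k') \in B$. A Boolean circuit is built from input nodes, negations, and AND- and OR-gates of arbitrary fan-in; its depth is the maximum number of gates, and its weft the maximum number of gates of fan-in more than $2$, on a path to the output. The class $\mathrm{W}[1]$ consists of all parameterized problems that are reducible, for some constant $h$, to the following problem with parameter $k$: given a circuit of weft at most $1$ and depth at most $h$, and $k \in \mathbb{N}$, is there a satisfying assignment that sets exactly $k$ input variables to true? \textbf{Theorem.} \textsc{Critical Node Cut} parameterized by $k$ is $\mathrm{W}[1]$-hard, that is, every problem in $\mathrm{W}[1]$ is reducible to it. -/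

import Mathlib

namespace ParamComplexity

/-! ### Data: finite binary trees (S-expressions over a single atom)

These are the words over which problems are posed.  A bit string is the list of its bits, so
every decision problem over bit strings is, up to a linear change of size, a problem over trees. -/

/-- S-expressions over one atom `nil`. -/
inductive SExp : Type
  | nil : SExp
  | cons : SExp → SExp → SExp
  deriving DecidableEq

namespace SExp

/-- The length of an S-expression: the number of its nodes. -/
def size : SExp → ℕ
  | nil => 1
  | cons a b => size a + size b + 1

/-- First component (`nil` for the atom). -/
def hd : SExp → SExp
  | nil => nil
  | cons a _ => a

/-- Second component (`nil` for the atom). -/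
def tl : SExp → SExp
  | nil => nil
  | cons _ b => b

/-- Natural numbers in unary. -/
def num : ℕ → SExp
  | 0 => nil
  | n + 1 => cons nil (num n)

/-- Lists of S-expressions. -/
def list : List SExp → SExp
  | [] => nil
  | a :: l => cons a (list l)

end SExp

/-! ### The machine model: WHILE programs on S-expressions, with running time

A store has a variable for every natural number.  The running time of a program is the sum of the
costs of the elementary steps that it performs; an elementary step costs one plus the total size
of all values that occur in it, so that time is polynomially related to Turing machine time
(in particular no value can be larger than the time spent to build it). -/

/-- Stores. -/
abbrev Store : Type := ℕ → SExp

/-- Expressions. -/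
inductive Expr : Type
  | var : ℕ → Expr
  | nil : Expr
  | cons : Expr → Expr → Expr
  | hd : Expr → Expr
  | tl : Expr → Expr
  | eq : Expr → Expr → Expr

namespace Expr

/-- The value of an expression; an equality test yields a non-`nil` value iff it succeeds. -/
def val (s : Store) : Expr → SExp
  | var i => s i
  | nil => SExp.nil
  | cons a b => SExp.cons (val s a) (val s b)
  | hd a => (val s a).hd
  | tl a => (val s a).tl
  | eq a b => if val s a = val s b then SExp.cons SExp.nil SExp.nil else SExp.nil

/-- The cost of evaluating an expression: the sum of the sizes of the values of all its
subexpressions (itself included). -/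
def cost (s : Store) : Expr → ℕ
  | var i => (s i).size
  | nil => 1
  | cons a b => cost s a + cost s b + (val s (cons a b)).size
  | hd a => cost s a + (val s (hd a)).size
  | tl a => cost s a + (val s (tl a)).size
  | eq a b => cost s a + cost s b + (val s (eq a b)).size

end Expr

/-- Programs. -/
inductive Prog : Type
  | assign : ℕ → Expr → Prog
  | seq : Prog → Prog → Prog
  | ite : Expr → Prog → Prog → Prog
  | loop : Expr → Prog → Prog

/-- `Exec p s t s'`: started in the store `s`, the program `p` halts after time `t` in the store
`s'`.  In conditionals and loops, a test counts as true iff its value is not `nil`;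
`loop e p` repeats `p` as long as `e` is true. -/
inductive Exec : Prog → Store → ℕ → Store → Prop
  | assign (i : ℕ) (e : Expr) (s : Store) :
      Exec (Prog.assign i e) s (e.cost s + 1) (Function.update s i (e.val s))
  | seq {p q : Prog} {s s' s'' : Store} {t t' : ℕ} :
      Exec p s t s' → Exec q s' t' s'' → Exec (Prog.seq p q) s (t + t') s''
  | ite_true {e : Expr} {p q : Prog} {s s' : Store} {t : ℕ} :
      e.val s ≠ SExp.nil → Exec p s t s' → Exec (Prog.ite e p q) s (e.cost s + 1 + t) s'
  | ite_false {e : Expr} {p q : Prog} {s s' : Store} {t : ℕ} :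
      e.val s = SExp.nil → Exec q s t s' → Exec (Prog.ite e p q) s (e.cost s + 1 + t) s'
  | loop_true {e : Expr} {p : Prog} {s s' s'' : Store} {t t' : ℕ} :
      e.val s ≠ SExp.nil → Exec p s t s' → Exec (Prog.loop e p) s' t' s'' →
      Exec (Prog.loop e p) s (e.cost s + 1 + t + t') s''
  | loop_false {e : Expr} {p : Prog} {s : Store} :
      e.val s = SExp.nil → Exec (Prog.loop e p) s (e.cost s + 1) s

/-- The initial store on the input `a`: variable `0` holds `a`, all others hold `nil`. -/
def inputStore (a : SExp) : Store := Function.update (fun _ => SExp.nil) 0 a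

/-- On input `a`, the program `p` halts after time `t` with output `b` (in variable `0`). -/
def Outputs (p : Prog) (a : SExp) (t : ℕ) (b : SExp) : Prop :=
  ∃ s : Store, Exec p (inputStore a) t s ∧ s 0 = b

/-! ### Parameterized problems and reductions -/

/-- A parameterized problem: a set of pairs (instance, parameter). -/
abbrev ParamProblem : Type := Set (SExp × ℕ)

/-- The pair (instance, parameter) as an input or output of a program. -/
def pair (x : SExp) (k : ℕ) : SExp := SExp.cons x (SExp.num k)

/-- Parameterized many-one reducibility: some program maps each `(x, k)` in time
`f k * |x| ^ c` to some `(x', k')` with `k' ≤ g k` that is a yes-instance of `B` iff `(x, k)` is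
one of `A`, where `f` and `g` are computable and `c` is a constant. -/
def FPTReducible (A B : ParamProblem) : Prop :=
  ∃ (p : Prog) (f g : ℕ → ℕ) (c : ℕ), Computable f ∧ Computable g ∧
    ∀ (x : SExp) (k : ℕ), ∃ (x' : SExp) (k' t : ℕ),
      Outputs p (pair x k) t (pair x' k') ∧ t ≤ f k * x.size ^ c ∧ k' ≤ g k ∧
        ((x, k) ∈ A ↔ (x', k') ∈ B)

/-! ### Boolean circuits, weft, and the classes `W[t]` -/

/-- A node of a circuit: an input node, or a gate together with the indices of the nodes that
feed it. -/
inductive Gate : Type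
  | inp : ℕ → Gate
  | not : ℕ → Gate
  | and : List ℕ → Gate
  | or : List ℕ → Gate

namespace Gate

/-- The nodes that feed a node. -/
def preds : Gate → List ℕ
  | inp _ => []
  | not j => [j]
  | and js => js
  | or js => js

/-- Large gates are those of fan-in more than two. -/
def IsLarge (g : Gate) : Prop := 2 < g.preds.length

instance (g : Gate) : Decidable g.IsLarge := inferInstanceAs (Decidable (2 < g.preds.length))

/-- The value of a node, if exactly the input variables in `S` are true and `vs` lists the values
of the preceding nodes. -/
def value (S : Finset ℕ) (vs : List Bool) : Gate → Bool
  | inp i => decide (i ∈ S)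
  | not j => !(vs.getD j false)
  | and js => js.all fun j => vs.getD j false
  | or js => js.any fun j => vs.getD j false

/-- The largest number of gates on a path ending in a node, if `ds` lists these numbers for the
preceding nodes. -/
def depth (ds : List ℕ) : Gate → ℕ
  | inp _ => 0
  | g => (g.preds.map fun j => ds.getD j 0).foldr max 0 + 1

/-- The largest number of large gates on a path ending in a node, if `ws` lists these numbers for
the preceding nodes. -/
def weft (ws : List ℕ) (g : Gate) : ℕ :=
  (g.preds.map fun j => ws.getD j 0).foldr max 0 + if g.IsLarge then 1 else 0

/-- Encoding of nodes. -/
def enc : Gate → SExp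
  | inp i => SExp.cons (SExp.num 0) (SExp.num i)
  | not j => SExp.cons (SExp.num 1) (SExp.num j)
  | and js => SExp.cons (SExp.num 2) (SExp.list (js.map SExp.num))
  | or js => SExp.cons (SExp.num 3) (SExp.list (js.map SExp.num))

end Gate

/-- A circuit: the number of its input variables `0, …, inputs - 1`, and its nodes in topological
order; the last node is the output node. -/
structure Circuit : Type where
  inputs : ℕ
  gates : List Gate

namespace Circuit

/-- There is an output node, each node is fed by earlier nodes only, and the input nodes carry
variables of the circuit. -/
def WellFormed (C : Circuit) : Prop :=
  C.gates ≠ [] ∧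
  (∀ (i : ℕ) (g : Gate), C.gates[i]? = some g → ∀ j ∈ g.preds, j < i) ∧
  ∀ i : ℕ, Gate.inp i ∈ C.gates → i < C.inputs

/-- Runs through the nodes in order, and lists for each node the result of `step`, which may use
the list of the results for the preceding nodes. -/
def run {β : Type} (step : List β → Gate → β) (gs : List Gate) : List β :=
  gs.foldl (fun vs g => vs ++ [step vs g]) []

/-- The value of the output node if exactly the input variables in `S` are true. -/
def eval (C : Circuit) (S : Finset ℕ) : Bool := (run (Gate.value S) C.gates).getLastD false

/-- The largest number of gates on a path to the output node. -/
def depth (C : Circuit) : ℕ := (run Gate.depth C.gates).getLastD 0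

/-- The largest number of large gates on a path to the output node. -/
def weft (C : Circuit) : ℕ := (run Gate.weft C.gates).getLastD 0

/-- Encoding of circuits. -/
def enc (C : Circuit) : SExp := SExp.cons (SExp.num C.inputs) (SExp.list (C.gates.map Gate.enc))

end Circuit

/-- Weighted circuit satisfiability for circuits of weft at most `t` and depth at most `h`,
parameterized by the weight: does the circuit have a satisfying assignment that makes exactly `k`
input variables true? -/
def weightedCircuitSat (t h : ℕ) : ParamProblem :=
  {a | ∃ C : Circuit, C.WellFormed ∧ C.weft ≤ t ∧ C.depth ≤ h ∧ a.1 = C.enc ∧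
    ∃ S : Finset ℕ, S ⊆ Finset.range C.inputs ∧ S.card = a.2 ∧ C.eval S = true}

/-- The class `W[t]`: the problems that are reducible, for some constant `h`, to weighted
satisfiability of circuits of weft at most `t` and depth at most `h`. -/
def W (t : ℕ) : Set ParamProblem := {L | ∃ h : ℕ, FPTReducible L (weightedCircuitSat t h)}

/-- `W[1]`-hardness: every problem in `W[1]` is reducible to `B`. -/
def W1Hard (B : ParamProblem) : Prop := ∀ A ∈ W 1, FPTReducible A B

/-! ### Critical Node Cut -/

/-- The ordered connected pairs of `G - C`: the pairs of distinct vertices of `G - C` that lie in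
the same connected component of `G - C`. -/
def connectedPairs {V : Type} (G : SimpleGraph V) (C : Finset V) :
    Set ({v : V | v ∉ C} × {v : V | v ∉ C}) :=
  {p | p.1 ≠ p.2 ∧ (G.induce {v : V | v ∉ C}).Reachable p.1 p.2}

/-- Some set of at most `k` vertices leaves at most `x` connected pairs when removed. -/
def HasCriticalNodeCut {n : ℕ} (G : SimpleGraph (Fin n)) (k x : ℕ) : Prop :=
  ∃ C : Finset (Fin n), C.card ≤ k ∧ (connectedPairs G C).ncard ≤ x

/-- `E` lists the edges of the simple graph `G` (each in at least one of its two directions). -/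
def ListsEdges {n : ℕ} (G : SimpleGraph (Fin n)) (E : List (Fin n × Fin n)) : Prop :=
  ∀ u v : Fin n, G.Adj u v ↔ (u, v) ∈ E ∨ (v, u) ∈ E

/-- Encoding of a graph on `n` vertices with edge list `E`, together with the bound `x`. -/
def encGraph {n : ℕ} (E : List (Fin n × Fin n)) (x : ℕ) : SExp :=
  SExp.cons (SExp.num n) (SExp.cons
    (SExp.list (E.map fun e => SExp.cons (SExp.num e.1.val) (SExp.num e.2.val)))
    (SExp.num x))

/-- Critical Node Cut, parameterized by the cut size `k`. The instance consists of the graph, as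
an edge list, and the bound `x`. (Numbers are in unary, which can only make the problem easier;
hardness for `x` in binary follows.) -/
def criticalNodeCut : ParamProblem :=
  {a | ∃ (n : ℕ) (G : SimpleGraph (Fin n)) (E : List (Fin n × Fin n)) (x : ℕ),
    ListsEdges G E ∧ a.1 = encGraph E x ∧ HasCriticalNodeCut G a.2 x}

end ParamComplexity

namespace ParamComplexity

/-! ### Running programs within time bounds -/

/-! A problem in W[1] comes with a parameterized reduction to weighted satisfiability of circuits of
weft at most one and some fixed depth `h`. By `FPTReducible.trans_polyTime` it remains to map such
circuits to graphs in polynomial time, with the parameter going from `k` to at most `k + 1`.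

The graphs are cliques with one extra vertex for each list in a family `H`, joined to the clique
vertices in that list. After a deletion, an extra vertex is cut off exactly when its whole list is
gone, and everything else stays in one component (`connectedPairs_ncard`). Few connected pairs
therefore means many lists inside the deleted set: the cut problem asks whether at most `K` vertices
contain at least `θ` members of `H` (`inside_of_hasCriticalNodeCut`,
`hasCriticalNodeCut_of_inside`).

The number of lists inside `S` is a polynomial in the indicator of `S`, with one positive monomial
per list. Negative monomials are simulated: all bounded-length lists except `T` contribute minus the
monomial `T` plus a quantity that depends only on the number of available variables in `S`
(`inside_positivize`). That quantity strictly increases with this number, so it also forces `S` to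
use its full budget on these variables.

For fixed depth, a node of weft zero is a Boolean polynomial of bounded degree (`polyVal_nodePoly`),
and a node of weft at most one holds iff one of polynomially many conjunctions of equations `p = 1`
holds (`exists_guess_iff`). Each conjunction gets a selector variable. Selectors `y i` with sum `a`
enter through `∑ y i * ∑ (p - 1) + 1 - (a - 1) ^ 2`, which is at most one, with equality iff exactly
one conjunction is selected and it is satisfied. The budget `k + 1` pays for `k` true inputs and one
selector.

Polynomial running time is derived compositionally for the WHILE language, from closure of
`PolyTime` under composition, pairing, branching and size-bounded folds. -/

theorem SExp.size_pos (a : SExp) : 0 < a.size := by cases a <;> simp [SExp.size]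

theorem SExp.size_hd_le (a : SExp) : a.hd.size ≤ a.size := by
  cases a <;> simp [SExp.size, SExp.hd]; omega

theorem SExp.size_tl_le (a : SExp) : a.tl.size ≤ a.size := by
  cases a <;> simp [SExp.size, SExp.tl]; omega

theorem Expr.size_val_le_cost (s : Store) (e : Expr) : (e.val s).size ≤ e.cost s := by
  cases e <;> simp [Expr.val, Expr.cost, SExp.size]

/-- An assignment costs at least the size of the value it stores. Running time thus bounds output
size, which is what allows reductions to be composed. -/
theorem Exec.size_le {p : Prog} {s s' : Store} {t : ℕ} (h : Exec p s t s') (i : ℕ) :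
    (s' i).size ≤ (s i).size + t := by
  induction h with
  | assign j e s =>
    have := e.size_val_le_cost s
    by_cases hj : i = j
    · subst hj; simp; omega
    · simp [hj]
  | seq _ _ h1 h2 => omega
  | ite_true _ _ h => omega
  | ite_false _ _ h => omega
  | loop_true _ _ _ h1 h2 => omega
  | loop_false _ => omega

/-- `p` leads from the store `s` to the store `s'` within time `T`. -/
def Run (p : Prog) (s : Store) (T : ℕ) (s' : Store) : Prop := ∃ t ≤ T, Exec p s t s'

theorem Run.assign (i : ℕ) (e : Expr) (s : Store) :
    Run (Prog.assign i e) s (e.cost s + 1) (Function.update s i (e.val s)) :=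
  ⟨_, le_rfl, Exec.assign i e s⟩

theorem Run.assign_of {i : ℕ} {e : Expr} {s : Store} {v : SExp} {T : ℕ} (hv : e.val s = v)
    (hT : e.cost s ≤ T) : Run (Prog.assign i e) s (T + 1) (Function.update s i v) :=
  ⟨_, by omega, hv ▸ Exec.assign i e s⟩

theorem Run.seq {p q : Prog} {s s' s'' : Store} {T T' : ℕ} (h : Run p s T s')
    (h' : Run q s' T' s'') : Run (Prog.seq p q) s (T + T') s'' := by
  obtain ⟨t, ht, h⟩ := h
  obtain ⟨t', ht', h'⟩ := h'
  exact ⟨t + t', by omega, Exec.seq h h'⟩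

theorem Run.mono {p : Prog} {s s' : Store} {T T' : ℕ} (h : Run p s T s') (hT : T ≤ T') :
    Run p s T' s' := by
  obtain ⟨t, ht, h⟩ := h
  exact ⟨t, ht.trans hT, h⟩

theorem Run.size_le {p : Prog} {s s' : Store} {T : ℕ} (h : Run p s T s') (i : ℕ) :
    (s' i).size ≤ (s i).size + T := by
  obtain ⟨t, ht, h⟩ := h
  have := h.size_le i
  omega

theorem eval_mono (P : Polynomial ℕ) {a b : ℕ} (h : a ≤ b) : P.eval a ≤ P.eval b := by
  induction P using Polynomial.induction_on' with
  | add p q hp hq => simp only [Polynomial.eval_add]; omega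
  | monomial n c => simp only [Polynomial.eval_monomial]; gcongr

/-- Types whose elements are encoded by S-expressions. -/
class Enc (α : Type) where
  enc : α → SExp
  enc_injective : Function.Injective enc

/-! ### Codes of pairs, Booleans, lists and numbers. -/

open Enc

instance : Enc SExp := ⟨fun x => x, fun _ _ h => h⟩

instance {α β : Type} [Enc α] [Enc β] : Enc (α × β) :=
  ⟨fun p => SExp.cons (enc p.1) (enc p.2), fun p q h => by
    simp only [SExp.cons.injEq] at h
    exact Prod.ext (enc_injective h.1) (enc_injective h.2)⟩

instance : Enc Bool :=
  ⟨fun b => if b then SExp.cons SExp.nil SExp.nil else SExp.nil, by decide⟩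

theorem SExp.list_injective : Function.Injective SExp.list := by
  intro l
  induction l with
  | nil => intro l' h; cases l' <;> simp_all [SExp.list]
  | cons a l ih =>
    intro l' h
    cases l' with
    | nil => simp [SExp.list] at h
    | cons b l' =>
      simp only [SExp.list, SExp.cons.injEq] at h
      rw [h.1, ih h.2]

instance {α : Type} [Enc α] : Enc (List α) :=
  ⟨fun l => SExp.list (l.map enc), SExp.list_injective.comp
    (List.map_injective_iff.mpr enc_injective)⟩

theorem SExp.num_injective : Function.Injective SExp.num := by
  intro n
  induction n with
  | zero => intro m h; cases m <;> simp_all [SExp.num]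
  | succ n ih =>
    intro m h
    cases m with
    | zero => simp [SExp.num] at h
    | succ m => simp only [SExp.num, SExp.cons.injEq, true_and] at h; rw [ih h]

instance : Enc ℕ := ⟨SExp.num, SExp.num_injective⟩

theorem enc_pair {α β : Type} [Enc α] [Enc β] (a : α) (b : β) :
    enc (a, b) = SExp.cons (enc a) (enc b) := rfl

theorem hd_enc {α β : Type} [Enc α] [Enc β] (p : α × β) : (enc p).hd = enc p.1 := rfl

theorem tl_enc {α β : Type} [Enc α] [Enc β] (p : α × β) : (enc p).tl = enc p.2 := rfl

theorem enc_true : enc true = SExp.cons SExp.nil SExp.nil := rfl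

theorem enc_false : enc false = SExp.nil := rfl

theorem enc_nil {α : Type} [Enc α] : enc ([] : List α) = SExp.nil := rfl

theorem enc_cons {α : Type} [Enc α] (a : α) (l : List α) :
    enc (a :: l) = SExp.cons (enc a) (enc l) := rfl

/-- The length of the encoding. -/
def esize {α : Type} [Enc α] (a : α) : ℕ := (enc a).size

theorem esize_pair {α β : Type} [Enc α] [Enc β] (a : α) (b : β) :
    esize (a, b) = esize a + esize b + 1 := rfl

theorem esize_nil {α : Type} [Enc α] : esize ([] : List α) = 1 := rfl

theorem esize_cons {α : Type} [Enc α] (a : α) (l : List α) :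
    esize (a :: l) = esize a + esize l + 1 := rfl

theorem esize_pos {α : Type} [Enc α] (a : α) : 0 < esize a := SExp.size_pos _

/-- `f` is computed in polynomial time, with input and output in variable `0`, by programs that
start in an arbitrary store and leave an arbitrary number of other variables untouched. -/
def PolyTime {α β : Type} [Enc α] [Enc β] (f : α → β) : Prop :=
  ∃ P : Polynomial ℕ, ∀ m : ℕ, ∃ p : Prog, ∀ (a : α) (s : Store), s 0 = enc a → ∃ s' : Store,
    Run p s (P.eval (esize a)) s' ∧ s' 0 = enc (f a) ∧ ∀ i, 0 < i → i < m → s' i = s i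

/-! ### Closure of polynomial time under composition, pairing, branching and folding. -/

section Closure

variable {α β γ δ : Type} [Enc α] [Enc β] [Enc γ] [Enc δ]

theorem PolyTime.exists_size_le {f : α → β} (hf : PolyTime f) :
    ∃ P : Polynomial ℕ, ∀ a, esize (f a) ≤ P.eval (esize a) := by
  obtain ⟨P, hP⟩ := hf
  refine ⟨Polynomial.X + P, fun a => ?_⟩
  obtain ⟨p, hp⟩ := hP 0
  obtain ⟨s', h1, h2, -⟩ := hp a (inputStore (enc a)) (by simp [inputStore])
  have := h1.size_le 0
  rw [h2] at this
  simpa [inputStore, esize] using this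

theorem PolyTime.of_expr {f : α → β} (e : Expr) (P : Polynomial ℕ)
    (hf : ∀ (a : α) (s : Store), s 0 = enc a → e.val s = enc (f a))
    (hP : ∀ (a : α) (s : Store), s 0 = enc a → e.cost s ≤ P.eval (esize a)) : PolyTime f := by
  refine ⟨P + 1, fun m => ⟨Prog.assign 0 e, fun a s hs =>
    ⟨_, (Run.assign 0 e s).mono ?_, ?_, ?_⟩⟩⟩
  · simpa using hP a s hs
  · simpa using hf a s hs
  · intro i hi _
    simp [hi.ne']

theorem PolyTime.const (b : β) : PolyTime fun _ : α => b := by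
  -- A fixed tree is the value of a closed expression, whose cost does not depend on the store.
  have key : ∀ x : SExp, ∃ e : Expr, ∃ n : ℕ, ∀ s, e.val s = x ∧ e.cost s ≤ n := by
    intro x
    induction x with
    | nil => exact ⟨.nil, 1, fun s => ⟨rfl, le_rfl⟩⟩
    | cons x y hx hy =>
      obtain ⟨e, n, he⟩ := hx
      obtain ⟨e', n', he'⟩ := hy
      refine ⟨.cons e e', n + n' + (SExp.cons x y).size, fun s => ?_⟩
      simp only [Expr.val, Expr.cost, he, he', true_and]
      have := (he s).2
      have := (he' s).2
      omega
  obtain ⟨e, n, he⟩ := key (enc b)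
  exact PolyTime.of_expr e (n : Polynomial ℕ) (fun _ s _ => (he s).1) fun a s _ => by
    simpa using (he s).2

theorem PolyTime.fst : PolyTime fun p : α × β => p.1 :=
  PolyTime.of_expr (Expr.hd (Expr.var 0)) (2 * Polynomial.X)
    (fun p s h => by simp [Expr.val, h, hd_enc]) fun p s h => by
      have := SExp.size_hd_le (enc p)
      simp only [Expr.cost, Expr.val, h, esize, Polynomial.eval_mul, Polynomial.eval_X,
        Polynomial.eval_ofNat]
      omega

theorem PolyTime.snd : PolyTime fun p : α × β => p.2 :=
  PolyTime.of_expr (Expr.tl (Expr.var 0)) (2 * Polynomial.X)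
    (fun p s h => by simp [Expr.val, h, tl_enc]) fun p s h => by
      have := SExp.size_tl_le (enc p)
      simp only [Expr.cost, Expr.val, h, esize, Polynomial.eval_mul, Polynomial.eval_X,
        Polynomial.eval_ofNat]
      omega

/-- Functions with the same input and output words are equally hard to compute. -/
theorem PolyTime.recode {f : α → β} (hf : PolyTime f) {g : γ → δ} (i : γ → α)
    (hi : ∀ c, enc c = enc (i c)) (hg : ∀ c, enc (g c) = enc (f (i c))) : PolyTime g := by
  obtain ⟨P, hP⟩ := hf
  refine ⟨P, fun m => ?_⟩
  obtain ⟨p, hp⟩ := hP m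
  refine ⟨p, fun c s hs => ?_⟩
  rw [hg]
  unfold esize
  rw [hi]
  exact hp (i c) s (hs.trans (hi c))

theorem PolyTime.eq_aux [DecidableEq α] : PolyTime fun p : α × α => decide (p.1 = p.2) :=
  PolyTime.of_expr (Expr.eq (Expr.hd (Expr.var 0)) (Expr.tl (Expr.var 0)))
    (4 * Polynomial.X + 3) (fun p s h => by
      by_cases hp : p.1 = p.2
      · simp [Expr.val, h, hd_enc, tl_enc, hp, enc_true]
      · have : enc p.1 ≠ enc p.2 := fun h => hp (enc_injective h)
        simp [Expr.val, h, hd_enc, tl_enc, hp, this, enc_false]) fun p s hs => by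
    have := (s 0).size_tl_le
    have := (s 0).size_hd_le
    simp only [Expr.cost, Expr.val, esize, ← hs]
    by_cases h : (s 0).hd = (s 0).tl <;> simp [h, SExp.size] at * <;> omega

theorem PolyTime.comp {f : β → γ} {g : α → β} (hf : PolyTime f) (hg : PolyTime g) :
    PolyTime fun a => f (g a) := by
  obtain ⟨R, hR⟩ := hg.exists_size_le
  obtain ⟨P, hP⟩ := hf
  obtain ⟨Q, hQ⟩ := hg
  -- The second program runs on `g a`, whose size is at most `R` of the input size.
  refine ⟨Q + P.comp R, fun m => ?_⟩
  obtain ⟨p, hp⟩ := hP m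
  obtain ⟨q, hq⟩ := hQ m
  refine ⟨Prog.seq q p, fun a s hs => ?_⟩
  obtain ⟨s1, h1, h2, h3⟩ := hq a s hs
  obtain ⟨s2, h4, h5, h6⟩ := hp (g a) s1 h2
  refine ⟨s2, (h1.seq h4).mono ?_, h5, fun i hi hm => by rw [h6 i hi hm, h3 i hi hm]⟩
  have := eval_mono P (hR a)
  simp [Polynomial.eval_comp]; omega

theorem PolyTime.pair {F : α → β} {G : α → γ} (hF : PolyTime F) (hG : PolyTime G) :
    PolyTime fun x => (F x, G x) := by
  obtain ⟨RF, hRF⟩ := hF.exists_size_le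
  obtain ⟨RG, hRG⟩ := hG.exists_size_le
  obtain ⟨P, hP⟩ := hF
  obtain ⟨Q, hQ⟩ := hG
  refine ⟨10 * (P + Q + RF + RG + Polynomial.X + 1), fun m => ?_⟩
  -- Protecting all variables below `m + 3` keeps the saved input in `m + 1` and the first result in
  -- `m + 2` alive, while variables below `m` stay untouched for the caller.
  obtain ⟨p, hp⟩ := hP (m + 3)
  obtain ⟨q, hq⟩ := hQ (m + 3)
  refine ⟨.seq (.assign (m + 1) (.var 0)) (.seq p (.seq (.assign (m + 2) (.var 0))
    (.seq (.assign 0 (.var (m + 1))) (.seq q (.assign 0 (.cons (.var (m + 2)) (.var 0))))))),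
    fun a s hs => ?_⟩
  have r1 := Run.assign_of (i := m + 1) (e := .var 0) (v := enc a) (T := esize a) hs
    (by simp [Expr.cost, hs, esize])
  obtain ⟨s1, r2, e2, k2⟩ := hp a (Function.update s (m + 1) (enc a)) (by simp [hs])
  have r3 := Run.assign_of (i := m + 2) (e := .var 0) (v := enc (F a)) (T := esize (F a)) e2
    (by simp [Expr.cost, e2, esize])
  have hm1 : s1 (m + 1) = enc a := by simpa using k2 (m + 1) (by omega) (by omega)
  have r4 := Run.assign_of (i := 0) (e := .var (m + 1)) (v := enc a) (T := esize a)
    (s := Function.update s1 (m + 2) (enc (F a))) (by simp [Expr.val, hm1])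
    (by simp [Expr.cost, hm1, esize])
  obtain ⟨s2, r5, e5, k5⟩ := hq a (Function.update (Function.update s1 (m + 2) (enc (F a))) 0
    (enc a)) (by simp)
  have hm2 : s2 (m + 2) = enc (F a) := by simpa using k5 (m + 2) (by omega) (by omega)
  have r6 := Run.assign_of (i := 0) (e := .cons (.var (m + 2)) (.var 0)) (s := s2)
    (v := enc (F a, G a)) (T := 2 * (esize (F a) + esize (G a)) + 1)
    (by simp [Expr.val, hm2, e5, enc_pair])
    (by simp [Expr.cost, Expr.val, hm2, e5, esize, SExp.size]; omega)
  refine ⟨_, (r1.seq (r2.seq (r3.seq (r4.seq (r5.seq r6))))).mono ?_, ?_, ?_⟩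
  · have := hRF a
    have := hRG a
    simp
    omega
  · simp
  · intro i hi him
    have a1 := k2 i hi (by omega)
    have a2 := k5 i hi (by omega)
    simp only [Function.update_of_ne hi.ne', Function.update_of_ne (by omega : i ≠ m + 1),
      Function.update_of_ne (by omega : i ≠ m + 2)] at a1 a2 ⊢
    rw [a2, a1]

theorem Run.ite {e : Expr} {p q : Prog} {s s' : Store} {T : ℕ}
    (h : if e.val s = SExp.nil then Run q s T s' else Run p s T s') :
    Run (Prog.ite e p q) s (e.cost s + 1 + T) s' := by
  split_ifs at h with he
  · obtain ⟨t, ht, h⟩ := h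
    exact ⟨_, by omega, Exec.ite_false he h⟩
  · obtain ⟨t, ht, h⟩ := h
    exact ⟨_, by omega, Exec.ite_true he h⟩

theorem PolyTime.cond {F : α → Bool} {G H : α → β} (hF : PolyTime F) (hG : PolyTime G)
    (hH : PolyTime H) : PolyTime fun x => if F x then G x else H x := by
  obtain ⟨P, hP⟩ := hF
  obtain ⟨Q, hQ⟩ := hG
  obtain ⟨R, hR⟩ := hH
  refine ⟨10 * (P + Q + R + Polynomial.X + 1), fun m => ?_⟩
  obtain ⟨p, hp⟩ := hP (m + 3)
  obtain ⟨q, hq⟩ := hQ (m + 3)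
  obtain ⟨r, hr⟩ := hR (m + 3)
  refine ⟨.seq (.assign (m + 1) (.var 0)) (.seq p (.seq (.assign (m + 2) (.var 0))
    (.seq (.assign 0 (.var (m + 1))) (.ite (.var (m + 2)) q r)))), fun a s hs => ?_⟩
  have hF3 : (enc (F a)).size ≤ 3 := by cases F a <;> simp [enc, SExp.size]
  have r1 := Run.assign_of (i := m + 1) (e := .var 0) (v := enc a) (T := esize a) hs
    (by simp [Expr.cost, hs, esize])
  obtain ⟨s1, r2, e2, k2⟩ := hp a (Function.update s (m + 1) (enc a)) (by simp [hs])
  have r3 := Run.assign_of (i := m + 2) (e := .var 0) (v := enc (F a)) (T := 3) e2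
    (by simpa [Expr.cost, e2] using hF3)
  have hm1 : s1 (m + 1) = enc a := by simpa using k2 (m + 1) (by omega) (by omega)
  have r4 := Run.assign_of (i := 0) (e := .var (m + 1)) (v := enc a) (T := esize a)
    (s := Function.update s1 (m + 2) (enc (F a))) (by simp [Expr.val, hm1])
    (by simp [Expr.cost, hm1, esize])
  set s2 := Function.update (Function.update s1 (m + 2) (enc (F a))) 0 (enc a) with hs2
  have key : ∃ s' : Store, Run (.ite (.var (m + 2)) q r) s2
      (4 + (Q.eval (esize a) + R.eval (esize a))) s' ∧
      s' 0 = enc (if F a then G a else H a) ∧ ∀ i, 0 < i → i < m + 3 → s' i = s2 i := by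
    obtain ⟨s3, r5, e5, k5⟩ := hq a s2 (by simp [hs2])
    obtain ⟨s4, r6, e6, k6⟩ := hr a s2 (by simp [hs2])
    have hv : Expr.val s2 (.var (m + 2)) = enc (F a) := by simp [Expr.val, hs2]
    have hc : Expr.cost s2 (.var (m + 2)) ≤ 3 := by simpa [Expr.cost, hs2] using hF3
    cases hFa : F a
    · refine ⟨s4, (Run.ite (T := R.eval (esize a)) ?_).mono (by omega), by simpa using e6, k6⟩
      rw [hv, if_pos (by simp [hFa, enc])]
      exact r6
    · refine ⟨s3, (Run.ite (T := Q.eval (esize a)) ?_).mono (by omega), by simpa using e5, k5⟩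
      rw [hv, if_neg (by simp [hFa, enc])]
      exact r5
  obtain ⟨s3, r5, e5, k5⟩ := key
  refine ⟨_, (r1.seq (r2.seq (r3.seq (r4.seq r5)))).mono ?_, e5, ?_⟩
  · simp
    omega
  · intro i hi him
    have a1 := k2 i hi (by omega)
    have a2 := k5 i hi (by omega)
    simp only [hs2, Function.update_of_ne hi.ne', Function.update_of_ne (by omega : i ≠ m + 1),
      Function.update_of_ne (by omega : i ≠ m + 2)] at a1 a2 ⊢
    rw [a2, a1]

/-! ### Folding over lists -/

theorem length_le_esize (l : List α) : l.length ≤ esize l := by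
  induction l with
  | nil => simp
  | cons a l ih => rw [esize_cons, List.length_cons]; omega

/-- The loop that folds a step function over the list in variable `m + 3`, with context
in variable `m + 1` and accumulator in variable `m + 2`. -/
theorem Run.foldl {step : α × γ × β → γ} {P : Polynomial ℕ} {m : ℕ} {p : Prog}
    (hp : ∀ (a : α × γ × β) (s : Store), s 0 = enc a → ∃ s' : Store,
      Run p s (P.eval (esize a)) s' ∧ s' 0 = enc (step a) ∧
        ∀ i, 0 < i → i < m + 4 → s' i = s i) (x : α) (B : ℕ) (hx : esize x ≤ B) :
    ∀ (l : List β) (c : γ) (s : Store), esize l ≤ B → s (m + 1) = enc x → s (m + 2) = enc c →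
      s (m + 3) = enc l →
      (∀ l', l' <+: l → esize (l'.foldl (fun acc b => step (x, acc, b)) c) ≤ B) →
      ∃ s' : Store, Run (.loop (.var (m + 3)) (.seq (.assign 0 (.cons (.var (m + 1))
        (.cons (.var (m + 2)) (.hd (.var (m + 3)))))) (.seq p (.seq (.assign (m + 2) (.var 0))
          (.assign (m + 3) (.tl (.var (m + 3)))))))) s
          (l.length * (P.eval (3 * B + 2) + 14 * B + 50) + B + 1) s' ∧
        s' (m + 2) = enc (l.foldl (fun acc b => step (x, acc, b)) c) ∧
        ∀ i, 0 < i → i ≤ m → s' i = s i := by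
  intro l
  induction l with
  | nil =>
    intro c s hl h1 h2 h3 hacc
    refine ⟨s, ⟨_, ?_, Exec.loop_false (by simp [Expr.val, h3, enc_nil])⟩, h2, fun _ _ _ => rfl⟩
    simpa [Expr.cost, h3, esize] using hl
  | cons b l ih =>
    intro c s hl h1 h2 h3 hacc
    rw [esize_cons] at hl
    have b0 : esize c ≤ B := hacc [] (by simp)
    have b1 : esize (step (x, c, b)) ≤ B := hacc [b] (by simp)
    have r1 := Run.assign_of (s := s) (i := 0) (e := .cons (.var (m + 1))
      (.cons (.var (m + 2)) (.hd (.var (m + 3))))) (v := enc (x, c, b)) (T := 10 * B + 20)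
      (by simp [Expr.val, h1, h2, h3, enc_pair, enc_cons, SExp.hd]) (by
        simp only [esize] at *
        simp only [Expr.cost, Expr.val, h1, h2, h3, enc_cons, SExp.hd, SExp.size]
        omega)
    obtain ⟨s1, r2, e2, k2⟩ := hp (x, c, b) (Function.update s 0 (enc (x, c, b))) (by simp)
    have r3 := Run.assign_of (i := m + 2) (e := .var 0) (v := enc (step (x, c, b))) (T := B) e2
      (by simpa [Expr.cost, e2, esize] using b1)
    have hm3 : s1 (m + 3) = enc (b :: l) := by
      simpa [h3] using k2 (m + 3) (by omega) (by omega)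
    have hm1 : s1 (m + 1) = enc x := by
      simpa [h1] using k2 (m + 1) (by omega) (by omega)
    have r4 := Run.assign_of (i := m + 3) (e := .tl (.var (m + 3)))
      (s := Function.update s1 (m + 2) (enc (step (x, c, b)))) (v := enc l) (T := 2 * B) (by
        simp [Expr.val, hm3, enc_cons, SExp.tl]) (by
        simp only [esize] at *
        simp [Expr.cost, Expr.val, hm3, enc_cons, SExp.tl, SExp.size]; omega)
    obtain ⟨s', rl, el, kl⟩ := ih (step (x, c, b))
      (Function.update (Function.update s1 (m + 2) (enc (step (x, c, b)))) (m + 3) (enc l))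
      (by omega) (by simp [hm1]) (by simp) (by simp)
      (fun l' hl' => hacc (b :: l') (by simpa using hl'))
    obtain ⟨t, ht, hr⟩ := r1.seq (r2.seq (r3.seq r4))
    obtain ⟨t', ht', hr'⟩ := rl
    refine ⟨s', ⟨_, ?_, Exec.loop_true (by simp [Expr.val, h3, enc_cons]) hr hr'⟩, el, ?_⟩
    -- Context, accumulator and list element each have size at most `B`; the two pairing nodes give
    -- the `+ 2`.
    · have := eval_mono P (show esize (x, c, b) ≤ 3 * B + 2 by
        rw [esize_pair, esize_pair]; omega)
      simp only [esize] at *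
      simp only [Expr.cost, h3, enc_cons, SExp.size, List.length_cons, add_mul, one_mul]
      omega
    · intro i hi him
      have a1 := k2 i hi (by omega)
      have a2 := kl i hi (by omega)
      simp only [Function.update_of_ne hi.ne', Function.update_of_ne (by omega : i ≠ m + 2),
        Function.update_of_ne (by omega : i ≠ m + 3)] at a1 a2 ⊢
      rw [a2, a1]

/-- Iterating a polynomial-time step may blow up the accumulator exponentially, so a polynomial
bound on the accumulator after every prefix is part of the hypotheses. With it, each of the
polynomially many rounds is polynomial. -/
theorem PolyTime.foldl_aux {step : α × γ × β → γ} {init : α → γ} {lst : α → List β}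
    {B : Polynomial ℕ} (hstep : PolyTime step) (hinit : PolyTime init) (hlst : PolyTime lst)
    (hB : ∀ x l', l' <+: lst x →
      esize (l'.foldl (fun acc b => step (x, acc, b)) (init x)) ≤ B.eval (esize x)) :
    PolyTime fun x => (lst x).foldl (fun acc b => step (x, acc, b)) (init x) := by
  obtain ⟨RL, hRL⟩ := hlst.exists_size_le
  obtain ⟨P, hP⟩ := hstep
  obtain ⟨QI, hQI⟩ := hinit
  obtain ⟨QL, hQL⟩ := hlst
  -- One bound for the accumulators, the list and the context together.
  set BB : Polynomial ℕ := B + RL + Polynomial.X with hBB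
  refine ⟨BB * (P.comp (3 * BB + 2) + 14 * BB + 50) + 10 * (QI + QL + BB + 1), fun m => ?_⟩
  obtain ⟨p, hp⟩ := hP (m + 4)
  obtain ⟨q, hq⟩ := hQI (m + 4)
  obtain ⟨r, hr⟩ := hQL (m + 4)
  refine ⟨.seq (.assign (m + 1) (.var 0)) (.seq q (.seq (.assign (m + 2) (.var 0))
    (.seq (.assign 0 (.var (m + 1))) (.seq r (.seq (.assign (m + 3) (.var 0)) (.seq
      (.loop (.var (m + 3)) (.seq (.assign 0 (.cons (.var (m + 1))
        (.cons (.var (m + 2)) (.hd (.var (m + 3)))))) (.seq p (.seq (.assign (m + 2) (.var 0))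
          (.assign (m + 3) (.tl (.var (m + 3)))))))) (.assign 0 (.var (m + 2))))))))),
    fun a s hs => ?_⟩
  have hl := hRL a
  have hi : esize (init a) ≤ B.eval (esize a) := hB a [] (by simp)
  have hb := hB a _ List.prefix_rfl
  have hBe : BB.eval (esize a) = B.eval (esize a) + RL.eval (esize a) + esize a := by
    simp [hBB]
  have r1 := Run.assign_of (i := m + 1) (e := .var 0) (v := enc a) (T := esize a) hs
    (by simp [Expr.cost, hs, esize])
  obtain ⟨s1, r2, e2, k2⟩ := hq a (Function.update s (m + 1) (enc a)) (by simp [hs])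
  have r3 := Run.assign_of (i := m + 2) (e := .var 0) (v := enc (init a)) (T := esize (init a)) e2
    (by simp [Expr.cost, e2, esize])
  have hm1 : s1 (m + 1) = enc a := by simpa using k2 (m + 1) (by omega) (by omega)
  have r4 := Run.assign_of (i := 0) (e := .var (m + 1)) (v := enc a) (T := esize a)
    (s := Function.update s1 (m + 2) (enc (init a))) (by simp [Expr.val, hm1])
    (by simp [Expr.cost, hm1, esize])
  obtain ⟨s2, r5, e5, k5⟩ := hr a (Function.update (Function.update s1 (m + 2) (enc (init a))) 0
    (enc a)) (by simp)
  have r6 := Run.assign_of (i := m + 3) (e := .var 0) (v := enc (lst a)) (T := esize (lst a)) e5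
    (by simp [Expr.cost, e5, esize])
  have hm2 : s2 (m + 2) = enc (init a) := by simpa using k5 (m + 2) (by omega) (by omega)
  have hm3 : s2 (m + 1) = enc a := by simpa [hm1] using k5 (m + 1) (by omega) (by omega)
  obtain ⟨s3, r7, e7, k7⟩ := Run.foldl hp a (BB.eval (esize a)) (by omega) (lst a) (init a)
    (Function.update s2 (m + 3) (enc (lst a))) (by omega) (by simp [hm3]) (by simp [hm2])
    (by simp) (fun l' hl' => (hB a l' hl').trans (by omega))
  have r8 := Run.assign_of (i := 0) (e := .var (m + 2)) (T := B.eval (esize a)) e7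
    (by simpa [Expr.cost, e7, esize] using hb)
  refine ⟨_, (r1.seq (r2.seq (r3.seq (r4.seq (r5.seq (r6.seq (r7.seq r8))))))).mono ?_, ?_, ?_⟩
  · have h3 : (lst a).length * (P.eval (3 * BB.eval (esize a) + 2)
        + 14 * BB.eval (esize a) + 50) ≤ BB.eval (esize a) * (P.eval (3 * BB.eval (esize a) + 2)
        + 14 * BB.eval (esize a) + 50) :=
      Nat.mul_le_mul_right _ (by have := length_le_esize (lst a); omega)
    simp only [Polynomial.eval_add, Polynomial.eval_mul,
      Polynomial.eval_comp, Polynomial.eval_ofNat, Polynomial.eval_one]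
    omega
  · simp
  · intro i hi him
    have a1 := k2 i hi (by omega)
    have a2 := k5 i hi (by omega)
    have a3 := k7 i hi (by omega)
    simp only [Function.update_of_ne hi.ne', Function.update_of_ne (by omega : i ≠ m + 1),
      Function.update_of_ne (by omega : i ≠ m + 2),
      Function.update_of_ne (by omega : i ≠ m + 3)] at a1 a2 a3 ⊢
    rw [a3, a2, a1]

end Closure

/-! ### Polynomial time functions on lists and numbers -/

theorem esize_append {α : Type} [Enc α] (l l' : List α) :
    esize (l ++ l') + 1 = esize l + esize l' := by
  induction l with
  | nil => simp [esize_nil]; omega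
  | cons a l ih => simp only [List.cons_append, esize_cons]; omega

theorem esize_le_of_mem {α : Type} [Enc α] {a : α} {l : List α} (h : a ∈ l) :
    esize a ≤ esize l := by
  induction l with
  | nil => simp at h
  | cons b l ih =>
    rw [esize_cons]
    rcases List.mem_cons.mp h with rfl | h
    · omega
    · have := ih h; omega

theorem esize_le_of_suffix {α : Type} [Enc α] {l l' : List α} (h : l <:+ l') :
    esize l ≤ esize l' := by
  obtain ⟨k, rfl⟩ := h
  have := esize_append k l
  have := esize_pos k
  omega

theorem esize_le_of_prefix {α : Type} [Enc α] {l l' : List α} (h : l <+: l') :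
    esize l ≤ esize l' := by
  obtain ⟨k, rfl⟩ := h
  have := esize_append l k
  have := esize_pos k
  omega

theorem esize_reverse {α : Type} [Enc α] (l : List α) : esize l.reverse = esize l := by
  induction l with
  | nil => rfl
  | cons a l ih =>
    have := esize_append l.reverse [a]
    rw [esize_cons, esize_nil] at this
    rw [List.reverse_cons, esize_cons]
    omega

theorem esize_nat (n : ℕ) : esize n = 2 * n + 1 := by
  change (SExp.num n).size = _
  induction n with
  | zero => rfl
  | succ n ih => simp only [SExp.num, SExp.size, ih]; omega

instance : Enc Unit := ⟨fun _ => SExp.nil, fun _ _ _ => rfl⟩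

/-- Unary numbers and lists of units are the same words, so arithmetic is inherited from list
operations: addition from append, multiplication from `flatMap`, subtraction from `drop`. -/
theorem enc_nat (n : ℕ) : enc n = enc (List.replicate n ()) := by
  change SExp.num n = _
  induction n with
  | zero => rfl
  | succ n ih => rw [List.replicate_succ, enc_cons, ← ih]; rfl

theorem enc_list_unit (l : List Unit) : enc l.length = enc l := by
  rw [enc_nat]
  congr
  exact (List.eq_replicate_iff.mpr ⟨rfl, fun _ _ => rfl⟩).symm

namespace PolyTime

variable {α β γ δ : Type} [Enc α] [Enc β] [Enc γ] [Enc δ]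

theorem ofEq {f g : α → β} (hf : PolyTime f) (h : ∀ a, g a = f a) : PolyTime g := by
  rwa [show g = f from funext h]

theorem eq [DecidableEq β] {f g : α → β} (hf : PolyTime f) (hg : PolyTime g) :
    PolyTime fun a => decide (f a = g a) :=
  eq_aux.comp (hf.pair hg)

theorem not {f : α → Bool} (hf : PolyTime f) : PolyTime fun a => !f a :=
  (hf.cond (const false) (const true)).ofEq fun a => by
    cases h : f a <;> simp

theorem and {f g : α → Bool} (hf : PolyTime f) (hg : PolyTime g) : PolyTime fun a => f a && g a :=
  (hf.cond hg (const false)).ofEq fun a => by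
    cases h : f a <;> simp

theorem or {f g : α → Bool} (hf : PolyTime f) (hg : PolyTime g) : PolyTime fun a => f a || g a :=
  (hf.cond (const true) hg).ofEq fun a => by
    cases h : f a <;> simp

theorem xor {f g : α → Bool} (hf : PolyTime f) (hg : PolyTime g) : PolyTime fun a => f a ^^ g a :=
  (hf.cond hg.not hg).ofEq fun a => by
    cases h : f a <;> simp

/-- A function is computed along with the code of its value. -/
theorem of_enc {f : α → β} (hf : PolyTime fun a => enc (f a)) : PolyTime f :=
  hf.recode (fun a => a) (fun _ => rfl) fun _ => rfl

theorem toSExp {f : α → β} (hf : PolyTime f) : PolyTime fun a => enc (f a) :=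
  hf.recode (fun a => a) (fun _ => rfl) fun _ => rfl

theorem foldl {step : α → γ → β → γ} {init : α → γ} {lst : α → List β}
    (B : Polynomial ℕ) (hstep : PolyTime fun p : α × γ × β => step p.1 p.2.1 p.2.2)
    (hinit : PolyTime init) (hlst : PolyTime lst)
    (hB : ∀ x l', l' <+: lst x → esize (l'.foldl (step x) (init x)) ≤ B.eval (esize x)) :
    PolyTime fun x => (lst x).foldl (step x) (init x) :=
  foldl_aux hstep hinit hlst hB

theorem list_cons {f : α → β} {g : α → List β} (hf : PolyTime f) (hg : PolyTime g) :
    PolyTime fun a => f a :: g a :=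
  (hf.pair hg).recode (fun a => a) (fun _ => rfl) fun _ => rfl

theorem singleton {f : α → β} (hf : PolyTime f) : PolyTime fun a => [f a] :=
  hf.list_cons (const [])

theorem isEmpty {f : α → List β} (hf : PolyTime f) : PolyTime fun a => (f a).isEmpty :=
  (hf.toSExp.eq (const SExp.nil)).ofEq fun a => by
    cases f a <;> simp [enc_nil, enc_cons]

theorem tail {f : α → List β} (hf : PolyTime f) : PolyTime fun a => (f a).tail :=
  PolyTime.comp (of_expr (f := fun l : List β => l.tail) (Expr.tl (Expr.var 0))
    (2 * Polynomial.X) (fun l s h => by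
      simp only [Expr.val, h]; cases l <;> rfl) fun p s h => by
      have := SExp.size_tl_le (enc p)
      simp only [Expr.cost, Expr.val, h, esize, Polynomial.eval_mul, Polynomial.eval_X,
        Polynomial.eval_ofNat]
      omega) hf

theorem sexpHd : PolyTime SExp.hd :=
  of_expr (Expr.hd (Expr.var 0)) (2 * Polynomial.X) (fun l s h => by
      simp only [Expr.val, h]; rfl) fun p s h => by
      have := SExp.size_hd_le (enc p)
      simp only [Expr.cost, Expr.val, h, esize, Polynomial.eval_mul, Polynomial.eval_X,
        Polynomial.eval_ofNat]
      omega

theorem sexpTl : PolyTime SExp.tl :=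
  of_expr (Expr.tl (Expr.var 0)) (2 * Polynomial.X) (fun l s h => by
      simp only [Expr.val, h]; rfl) fun p s h => by
      have := SExp.size_tl_le (enc p)
      simp only [Expr.cost, Expr.val, h, esize, Polynomial.eval_mul, Polynomial.eval_X,
        Polynomial.eval_ofNat]
      omega

theorem headD {f : α → List β} (hf : PolyTime f) (d : β) : PolyTime fun a => (f a).headD d :=
  of_enc ((hf.isEmpty.cond (const (enc d)) (sexpHd.comp hf.toSExp)).ofEq fun a => by
    cases f a <;> simp [enc_cons, SExp.hd])

theorem reverse {f : α → List β} (hf : PolyTime f) : PolyTime fun a => (f a).reverse := by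
  obtain ⟨R, hR⟩ := hf.exists_size_le
  have key : ∀ l : List β, l.foldl (fun acc b => b :: acc) [] = l.reverse := by simp
  refine (foldl (step := fun _ acc b => b :: acc) (init := fun _ => []) R
    ((snd.comp snd).list_cons (fst.comp snd)) (const []) hf ?_).ofEq fun a => (key _).symm
  intro a l' hl'
  rw [key, esize_reverse]
  exact (esize_le_of_prefix hl').trans (hR a)

theorem append {f g : α → List β} (hf : PolyTime f) (hg : PolyTime g) :
    PolyTime fun a => f a ++ g a := by
  obtain ⟨R, hR⟩ := hf.exists_size_le
  obtain ⟨S, hS⟩ := hg.exists_size_le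
  have key : ∀ l l' : List β, l.foldl (fun acc b => b :: acc) l' = l.reverse ++ l' := by simp
  -- Pushing the elements of the reversed first list onto the second restores their order.
  refine (foldl (step := fun _ acc b => b :: acc) (R + S)
    ((snd.comp snd).list_cons (fst.comp snd)) hg hf.reverse ?_).ofEq fun a => by
      rw [key, List.reverse_reverse]
  intro a l' hl'
  rw [key]
  have h1 := esize_append l'.reverse (g a)
  have h2 := esize_le_of_prefix hl'
  rw [esize_reverse] at h1 h2
  have := hR a
  have := hS a
  simp only [Polynomial.eval_add]
  omega

theorem flatMap {l : α → List β} {g : α → β → List γ} (hl : PolyTime l)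
    (hg : PolyTime fun p : α × β => g p.1 p.2) : PolyTime fun a => (l a).flatMap (g a) := by
  obtain ⟨R, hR⟩ := hl.exists_size_le
  obtain ⟨S, hS⟩ := hg.exists_size_le
  have key : ∀ (h : β → List γ) (l : List β) (l' : List γ),
      l.foldl (fun acc b => acc ++ h b) l' = l' ++ l.flatMap h := by
    intro h l
    induction l with
    | nil => simp
    | cons b l ih => intro l'; simp [ih]
  refine (foldl (step := fun a acc b => acc ++ g a b) (init := fun _ => [])
    -- There are at most `R` pieces; each is `g` of a pair of size at most `X + R + 1`, and the
    -- final `1` is the empty list.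
    (R * S.comp (Polynomial.X + R + 1) + 1)
    ((fst.comp snd).append (hg.comp (fst.pair (snd.comp snd)))) (const []) hl ?_).ofEq
    fun a => by rw [key, List.nil_append]
  intro a l' hl'
  rw [key, List.nil_append]
  have hb : ∀ l'' : List β, (∀ b ∈ l'', b ∈ l a) → esize (l''.flatMap (g a))
      ≤ l''.length * S.eval (esize a + R.eval (esize a) + 1) + 1 := by
    intro l''
    induction l'' with
    | nil => intro _; simp [esize_nil]
    | cons b l'' ih =>
      intro h
      have h1 := ih fun b hb => h b (List.mem_cons_of_mem _ hb)
      have h2 : esize b ≤ R.eval (esize a) :=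
        (esize_le_of_mem (h b List.mem_cons_self)).trans (hR a)
      have h3 := hS (a, b)
      have h4 := eval_mono S (show esize (a, b) ≤ esize a + R.eval (esize a) + 1 by
        rw [esize_pair]; omega)
      have h5 := esize_append (g a b) (l''.flatMap (g a))
      simp only [List.flatMap_cons, List.length_cons, add_mul, one_mul] at *
      omega
  refine (hb l' fun b hb => hl'.subset hb).trans ?_
  have : l'.length ≤ R.eval (esize a) :=
    (length_le_esize l').trans ((esize_le_of_prefix hl').trans (hR a))
  simp only [Polynomial.eval_add, Polynomial.eval_mul, Polynomial.eval_comp, Polynomial.eval_X,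
    Polynomial.eval_one]
  gcongr

theorem map {l : α → List β} {g : α → β → γ} (hl : PolyTime l)
    (hg : PolyTime fun p : α × β => g p.1 p.2) : PolyTime fun a => (l a).map (g a) :=
  (flatMap (g := fun a b => [g a b]) hl hg.singleton).ofEq fun a => by
    rw [← List.flatMap_pure_eq_map]; rfl

theorem filter {l : α → List β} {p : α → β → Bool} (hl : PolyTime l)
    (hp : PolyTime fun q : α × β => p q.1 q.2) : PolyTime fun a => (l a).filter (p a) :=
  (flatMap (g := fun a b => if p a b then [b] else []) hl
    (hp.cond snd.singleton (const []))).ofEq fun a => by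
    induction l a with
    | nil => rfl
    | cons b l ih => rw [List.flatMap_cons, ← ih, List.filter_cons]; split_ifs <;> simp

theorem all {l : α → List β} {p : α → β → Bool} (hl : PolyTime l)
    (hp : PolyTime fun q : α × β => p q.1 q.2) : PolyTime fun a => (l a).all (p a) :=
  (filter (p := fun a b => !p a b) hl hp.not).isEmpty.ofEq fun a => by
    induction l a with
    | nil => rfl
    | cons b l ih => cases h : p a b <;> simp [h, ih]

theorem length {l : α → List β} (hl : PolyTime l) : PolyTime fun a => (l a).length :=
  (map (g := fun _ _ => ()) hl (const ())).recode (fun a => a) (fun _ => rfl) fun a => by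
    rw [← enc_list_unit]; simp

theorem units {f : α → ℕ} (hf : PolyTime f) : PolyTime fun a => List.replicate (f a) () :=
  hf.recode (fun a => a) (fun _ => rfl) fun _ => (enc_nat _).symm

theorem add {f g : α → ℕ} (hf : PolyTime f) (hg : PolyTime g) : PolyTime fun a => f a + g a :=
  (hf.units.append hg.units).length.ofEq fun a => by simp

theorem mul {f g : α → ℕ} (hf : PolyTime f) (hg : PolyTime g) : PolyTime fun a => f a * g a :=
  (flatMap (g := fun a _ => List.replicate (g a) ()) hf.units
    (hg.units.comp fst)).length.ofEq fun a => by simp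

theorem drop {f : α → List β} {n : α → ℕ} (hf : PolyTime f) (hn : PolyTime n) :
    PolyTime fun a => (f a).drop (n a) := by
  obtain ⟨R, hR⟩ := hf.exists_size_le
  have key : ∀ (u : List Unit) (l : List β),
      u.foldl (fun acc _ => acc.tail) l = l.drop u.length := by
    intro u
    induction u with
    | nil => simp
    | cons _ u ih => intro l; rw [List.foldl_cons, ih]; simp
  refine (foldl (step := fun _ acc _ => acc.tail) R (fst.comp snd).tail hf hn.units ?_).ofEq
    fun a => by rw [key, List.length_replicate]
  intro a l' _
  rw [key]
  exact (esize_le_of_suffix (List.drop_suffix _ _)).trans (hR a)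

theorem getD {f : α → List β} {n : α → ℕ} (hf : PolyTime f) (hn : PolyTime n) (d : β) :
    PolyTime fun a => (f a).getD (n a) d :=
  ((hf.drop hn).headD d).ofEq fun a => by
    rw [List.getD_eq_getElem?_getD, List.headD_eq_head?_getD, List.head?_drop]

theorem sub {f g : α → ℕ} (hf : PolyTime f) (hg : PolyTime g) : PolyTime fun a => f a - g a :=
  (hf.units.drop hg).length.ofEq fun a => by simp

theorem lt {f g : α → ℕ} (hf : PolyTime f) (hg : PolyTime g) :
    PolyTime fun a => decide (f a < g a) :=
  ((hg.sub hf).eq (const 0)).not.ofEq fun a => by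
    rw [← decide_not]
    exact decide_eq_decide.mpr (by omega)

theorem range {f : α → ℕ} (hf : PolyTime f) : PolyTime fun a => List.range (f a) := by
  obtain ⟨R, hR⟩ := hf.exists_size_le
  have key : ∀ u : List Unit,
      u.foldl (fun acc _ => acc ++ [acc.length]) [] = List.range u.length := by
    intro u
    induction u using List.reverseRecOn with
    | nil => simp
    | append_singleton u _ ih => simp [ih, List.range_succ]
  refine (foldl (step := fun _ acc _ => acc ++ [acc.length]) (init := fun _ => [])
    (R * (2 * R + 2) + 1) ((fst.comp snd).append (fst.comp snd).length.singleton)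
    (const []) hf.units ?_).ofEq fun a => by rw [key, List.length_replicate]
  intro a l' hl'
  rw [key]
  -- Each entry is below `n`, so its unary code together with its list node has size at most `2 * n
  -- + 2`.
  have hb : ∀ n : ℕ, esize (List.range n) ≤ n * (2 * n + 2) + 1 := by
    intro n
    induction n with
    | zero => simp [esize_nil]
    | succ n ih =>
      have := esize_append (List.range n) [n]
      rw [esize_cons, esize_nil, esize_nat] at this
      rw [List.range_succ]
      nlinarith
  have h1 := hl'.length_le
  have h2 := hR a
  rw [List.length_replicate] at h1
  rw [esize_nat] at h2
  refine (hb _).trans ?_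
  simp only [Polynomial.eval_add, Polynomial.eval_mul, Polynomial.eval_ofNat, Polynomial.eval_one]
  have h3 : l'.length ≤ R.eval (esize a) := by omega
  gcongr

end PolyTime

/-! ### Polynomial time reductions and parameterized reductions -/

/-- The single-power form is what separates parameter from input size: a power of a product `F k *
|x| ^ e` splits into two factors. -/
theorem exists_eval_le (P : Polynomial ℕ) : ∃ A d : ℕ, ∀ n, 1 ≤ n → P.eval n ≤ A * n ^ d := by
  induction P using Polynomial.induction_on' with
  | add p q hp hq =>
    obtain ⟨A, d, h⟩ := hp
    obtain ⟨A', d', h'⟩ := hq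
    refine ⟨A + A', d + d', fun n hn => ?_⟩
    rw [Polynomial.eval_add, add_mul]
    refine add_le_add ((h n hn).trans ?_) ((h' n hn).trans ?_) <;>
      exact Nat.mul_le_mul_left _ (Nat.pow_le_pow_right hn (by omega))
  | monomial d A => exact ⟨A, d, fun n _ => by rw [Polynomial.eval_monomial]⟩

theorem primrec_pow_const (d : ℕ) : Primrec fun n : ℕ => n ^ d := by
  induction d with
  | zero => simpa using Primrec.const 1
  | succ d ih => simp only [pow_succ]; exact Primrec.nat_mul.comp ih Primrec.id

theorem computable_time_bound {f : ℕ → ℕ} (hf : Computable f) (A d : ℕ) :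
    Computable fun k => f k + A * (f k + 2 * k + 3) ^ d := by
  have h : Primrec fun p : ℕ × ℕ => p.1 + A * (p.1 + 2 * p.2 + 3) ^ d :=
    Primrec.nat_add.comp Primrec.fst (Primrec.nat_mul.comp (Primrec.const A)
      ((primrec_pow_const d).comp (Primrec.nat_add.comp (Primrec.nat_add.comp Primrec.fst
        (Primrec.nat_mul.comp (Primrec.const 2) Primrec.snd)) (Primrec.const 3))))
  exact h.to_comp.comp (hf.pair Computable.id)

/-- A parameterized reduction may be followed by a polynomial time many-one reduction that
increases the parameter by at most one. -/
theorem FPTReducible.trans_polyTime {A B C : ParamProblem} (h : FPTReducible A B)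
    {R : SExp × ℕ → SExp × ℕ} (hR : PolyTime R) (hk : ∀ a, (R a).2 ≤ a.2 + 1)
    (hiff : ∀ a, a ∈ B ↔ R a ∈ C) : FPTReducible A C := by
  obtain ⟨p, f, g, c, hf, hg, hp⟩ := h
  obtain ⟨P, hP⟩ := hR
  obtain ⟨q, hq⟩ := hP 0
  obtain ⟨K, d, hKd⟩ := exists_eval_le P
  refine ⟨Prog.seq p q, fun k => f k + K * (f k + 2 * k + 3) ^ d, fun k => g k + 1,
    c + (c + 1) * d, computable_time_bound hf K d, Primrec.succ.to_comp.comp hg, fun x k => ?_⟩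
  obtain ⟨x', k', t, ⟨s, hs, hs0⟩, ht, hk', hA⟩ := hp x k
  obtain ⟨s', ⟨t', ht', hs'⟩, h0, -⟩ := hq (x', k') s hs0
  refine ⟨(R (x', k')).1, (R (x', k')).2, t + t', ⟨s', hs.seq hs', h0⟩, ?_,
    (hk _).trans (by simpa using hk'), hA.trans (hiff _)⟩
  have hx := x.size_pos
  -- The intermediate word is at most as large as the input pair plus the time spent on it. The
  -- exponent `c + 1` instead of `c` absorbs the summand `x.size` even when `c = 0`.
  have h1 : esize (x', k') ≤ (f k + 2 * k + 3) * x.size ^ (c + 1) := by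
    have := hs.size_le 0
    rw [hs0] at this
    have e1 : (pair x' k').size = esize (x', k') := rfl
    have e2 : (inputStore (pair x k) 0).size = x.size + (2 * k + 1) + 1 := by
      rw [← esize_nat]; rfl
    have h2 : x.size ≤ x.size ^ (c + 1) := Nat.le_self_pow (by omega) _
    have h3 : x.size ^ c ≤ x.size ^ (c + 1) := Nat.pow_le_pow_right hx (by omega)
    have h4 : 1 ≤ x.size ^ (c + 1) := Nat.one_le_pow _ _ hx
    have h5 : f k * x.size ^ c ≤ f k * x.size ^ (c + 1) := Nat.mul_le_mul_left _ h3
    have h6 : 2 * k ≤ 2 * k * x.size ^ (c + 1) := Nat.le_mul_of_pos_right _ h4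
    simp only [add_mul]
    omega
  have h2 := hKd _ (esize_pos (x', k'))
  have h3 : esize (x', k') ^ d ≤ ((f k + 2 * k + 3) * x.size ^ (c + 1)) ^ d :=
    Nat.pow_le_pow_left h1 d
  have h4 : K * esize (x', k') ^ d ≤ K * (f k + 2 * k + 3) ^ d * x.size ^ ((c + 1) * d) := by
    rw [mul_pow, ← pow_mul] at h3
    rw [mul_assoc]
    exact Nat.mul_le_mul_left _ h3
  calc t + t' ≤ f k * x.size ^ c + K * (f k + 2 * k + 3) ^ d * x.size ^ ((c + 1) * d) := by omega
    _ ≤ f k * x.size ^ (c + (c + 1) * d)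
        + K * (f k + 2 * k + 3) ^ d * x.size ^ (c + (c + 1) * d) :=
      add_le_add (Nat.mul_le_mul_left _ (Nat.pow_le_pow_right hx (by omega)))
        (Nat.mul_le_mul_left _ (Nat.pow_le_pow_right hx (by omega)))
    _ = _ := by rw [← add_mul]

/-! ### Critical Node Cut on a clique with attached vertices -/

/-- The simple graph on `n` vertices with a given list of edges. -/
def graphOf (n : ℕ) (E : List (ℕ × ℕ)) : SimpleGraph (Fin n) :=
  SimpleGraph.fromRel fun u v => (u.val, v.val) ∈ E

/-- Injectivity of the code recovers the vertex number, the edge list and the bound, and the edge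
list determines the graph. Loops must be excluded: `fromRel` discards them, whereas `ListsEdges`
would demand them as edges. -/
theorem mem_criticalNodeCut_iff {n : ℕ} {E : List (ℕ × ℕ)} (x k : ℕ)
    (hE : ∀ e ∈ E, e.1 < n ∧ e.2 < n ∧ e.1 ≠ e.2) :
    (enc (n, E, x), k) ∈ criticalNodeCut ↔ HasCriticalNodeCut (graphOf n E) k x := by
  have henc : ∀ {m : ℕ} (F : List (Fin m × Fin m)) (y : ℕ),
      encGraph F y = enc (m, F.map fun e => (e.1.val, e.2.val), y) := by
    intro m F y
    change SExp.cons _ (SExp.cons (SExp.list _) _) = SExp.cons _ (SExp.cons (SExp.list _) _)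
    rw [List.map_map]
    rfl
  have hadj : ∀ F : List (Fin n × Fin n), F.map (fun e => (e.1.val, e.2.val)) = E →
      ∀ u v : Fin n, (u, v) ∈ F ↔ (u.val, v.val) ∈ E := by
    rintro F rfl u v
    simp only [List.mem_map, Prod.mk.injEq, Prod.exists]
    constructor
    · exact fun h => ⟨u, v, h, rfl, rfl⟩
    · rintro ⟨a, b, h, ha, hb⟩
      rwa [← Fin.ext ha, ← Fin.ext hb]
  constructor
  · rintro ⟨m, G, F, y, hF, henc', hcut⟩
    rw [henc] at henc'
    have := enc_injective henc'
    simp only [Prod.mk.injEq] at this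
    obtain ⟨rfl, hFE, rfl⟩ := this
    have hG : G = graphOf n E := by
      ext u v
      rw [hF, hadj F hFE.symm, hadj F hFE.symm, graphOf, SimpleGraph.fromRel_adj]
      refine ⟨fun h => ⟨?_, h⟩, fun h => h.2⟩
      rintro rfl
      exact (hE _ (h.elim id id)).2.2 rfl
    rwa [← hG]
  · intro hcut
    refine ⟨n, graphOf n E, E.pmap
      (fun e (h : e.1 < n ∧ e.2 < n) => ((⟨e.1, h.1⟩ : Fin n), (⟨e.2, h.2⟩ : Fin n))) fun e he =>
      ⟨(hE e he).1, (hE e he).2.1⟩, x, ?_, ?_, hcut⟩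
    · intro u v
      rw [hadj _ (by simp [List.map_pmap]), hadj _ (by simp [List.map_pmap]), graphOf,
        SimpleGraph.fromRel_adj]
      refine ⟨fun h => h.2, fun h => ⟨?_, h⟩⟩
      rintro rfl
      exact (hE _ (h.elim id id)).2.2 rfl
    · rw [henc]
      simp [List.map_pmap]

/-- A clique on the vertices below `c`, with one more vertex for each member of `H`, which is
adjacent to the elements of that member. -/
def cliqueEdges (c : ℕ) (H : List (List ℕ)) : List (ℕ × ℕ) :=
  ((List.range c).flatMap fun u => ((List.range c).filter fun v => !decide (u = v)).map
    fun v => (u, v)) ++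
  (List.range H.length).flatMap fun i => (H.getD i []).map fun u => (u, c + i)

theorem mem_cliqueEdges {c : ℕ} {H : List (List ℕ)} {u v : ℕ} : (u, v) ∈ cliqueEdges c H ↔
    (u < c ∧ v < c ∧ u ≠ v) ∨ (c ≤ v ∧ v - c < H.length ∧ u ∈ H.getD (v - c) []) := by
  simp only [cliqueEdges, List.mem_append, List.mem_flatMap, List.mem_map, List.mem_filter,
    List.mem_range, Prod.mk.injEq]
  apply or_congr
  · constructor
    · rintro ⟨a, ha, b, ⟨hb, hab⟩, rfl, rfl⟩
      exact ⟨ha, hb, by simpa using hab⟩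
    · rintro ⟨hu, hv, h⟩
      exact ⟨u, hu, v, ⟨hv, by simpa using h⟩, rfl, rfl⟩
  · constructor
    · rintro ⟨i, hi, w, hw, rfl, rfl⟩
      simpa using ⟨hi, hw⟩
    · rintro ⟨h1, h2, h3⟩
      exact ⟨v - c, h2, u, h3, rfl, by omega⟩

theorem getD_mem_of_mem_getD {H : List (List ℕ)} {i u : ℕ} (h : u ∈ H.getD i []) :
    i < H.length ∧ H.getD i [] ∈ H := by
  by_cases hi : i < H.length
  · refine ⟨hi, ?_⟩
    rw [List.getD_eq_getElem _ _ hi]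
    exact List.getElem_mem hi
  · rw [List.getD_eq_default _ _ (by omega)] at h
    simp at h

theorem cliqueEdges_lt {c : ℕ} {H : List (List ℕ)} (hH : ∀ T ∈ H, ∀ u ∈ T, u < c) :
    ∀ e ∈ cliqueEdges c H, e.1 < c + H.length ∧ e.2 < c + H.length ∧ e.1 ≠ e.2 := by
  rintro ⟨u, v⟩ h
  rcases mem_cliqueEdges.mp h with h | ⟨h1, h2, h3⟩
  · exact ⟨by simp only; omega, by simp only; omega, h.2.2⟩
  · have := hH _ (getD_mem_of_mem_getD h3).2 u h3
    exact ⟨by simp only; omega, by simp only; omega, by simp only [ne_eq]; omega⟩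

/-- Lists may occur several times in `H`, each occurrence with its own vertex, so positions have to
be counted rather than distinct members. -/
theorem card_filter_range_getD {α : Type} (l : List α) (p : α → Bool) (d : α) :
    ((Finset.range l.length).filter fun i => p (l.getD i d) = true).card = l.countP p := by
  induction l using List.reverseRecOn with
  | nil => simp
  | append_singleton l a ih =>
    rw [List.length_append, List.length_singleton, Finset.range_add_one, Finset.filter_insert,
      List.countP_append, ← ih]
    have h1 : ((Finset.range l.length).filter fun i => p ((l ++ [a]).getD i d) = true)
        = (Finset.range l.length).filter fun i => p (l.getD i d) = true := by
      apply Finset.filter_congr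
      intro i hi
      rw [List.getD_append _ _ _ _ (Finset.mem_range.mp hi)]
    have h2 : (l ++ [a]).getD l.length d = a := by simp
    rw [h1, h2]
    by_cases ha : p a = true
    · rw [if_pos ha, Finset.card_insert_of_notMem (by simp)]
      simp [ha]
    · rw [if_neg ha]
      simp [ha]

/-- How many members of `H` are contained in `S`. -/
def inside (H : List (List ℕ)) (S : Finset ℕ) : ℕ := H.countP fun T => T.all fun u => decide (u ∈ S)

/-! ### Connected pairs left by a cut, and covered lists. -/

section Cut

variable {c : ℕ} {H : List (List ℕ)}

/-- The vertices of the clique with attached vertices that are isolated by the removal of `C`. -/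
def isolated (c : ℕ) (H : List (List ℕ)) (C : Finset (Fin (c + H.length))) :
    Finset (Fin (c + H.length)) :=
  Finset.univ.filter fun v => v ∉ C ∧ c ≤ v.val ∧ ∀ u ∈ H.getD (v.val - c) [], u ∈ C.image Fin.val

/-- The surviving vertices that are not isolated form a single component: surviving clique vertices
are pairwise adjacent, and any other such vertex keeps a neighbour in the clique. The ordered pairs
are thus the off-diagonal pairs of this set. -/
theorem connectedPairs_ncard (hH : ∀ T ∈ H, ∀ u ∈ T, u < c) (C : Finset (Fin (c + H.length))) :
    (connectedPairs (graphOf (c + H.length) (cliqueEdges c H)) C).ncard =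
      ((Cᶜ \ isolated c H C).card) * ((Cᶜ \ isolated c H C).card - 1) := by
  set G := graphOf _ (cliqueEdges c H) with hG
  set R := Cᶜ \ isolated c H C with hR
  have hRmem : ∀ v, v ∈ R ↔ v ∉ C ∧ ¬ (c ≤ v.val ∧ ∀ u ∈ H.getD (v.val - c) [],
      u ∈ C.image Fin.val) := by
    intro v
    simp only [hR, isolated, Finset.mem_sdiff, Finset.mem_compl, Finset.mem_filter,
      Finset.mem_univ, true_and]
    tauto
  have hadj : ∀ u v, G.Adj u v ↔ u ≠ v ∧
      ((u.val, v.val) ∈ cliqueEdges c H ∨ (v.val, u.val) ∈ cliqueEdges c H) := by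
    intro u v
    rw [hG, graphOf, SimpleGraph.fromRel_adj]
  -- The first edge of a walk to a different vertex leads to a surviving neighbour, so neither
  -- endpoint of a connected pair is isolated.
  have hnbr : ∀ p q : {v | v ∉ C}, p ≠ q → (G.induce {v | v ∉ C}).Reachable p q →
      p.val ∈ R := by
    rintro p q hpq ⟨w⟩
    cases w with
    | nil => exact absurd rfl hpq
    | @cons _ r _ h _ =>
      have h := SimpleGraph.induce_adj.mp h
      rw [hadj] at h
      rw [hRmem]
      refine ⟨p.2, ?_⟩
      rintro ⟨h1, h2⟩
      rcases h.2 with h | h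
      · rcases mem_cliqueEdges.mp h with h | ⟨_, _, h3⟩
        · omega
        · have := hH _ (getD_mem_of_mem_getD h3).2 _ h3
          omega
      · rcases mem_cliqueEdges.mp h with h | ⟨_, _, h3⟩
        · omega
        · obtain ⟨r', hr', hrr⟩ := Finset.mem_image.mp (h2 _ h3)
          rw [Fin.val_injective hrr] at hr'
          exact r.2 hr'
  have hcore : ∀ p : {v | v ∉ C}, p.val ∈ R → ∃ q : {v | v ∉ C}, q.val.val < c ∧
      (G.induce {v | v ∉ C}).Reachable p q := by
    intro p hp
    by_cases hc : p.val.val < c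
    · exact ⟨p, hc, SimpleGraph.Reachable.refl p⟩
    · rw [hRmem] at hp
      have := hp.2
      push Not at this
      obtain ⟨u, hu, huC⟩ := this (by omega)
      have hlt := hH _ (getD_mem_of_mem_getD hu).2 _ hu
      have hlen := (getD_mem_of_mem_getD hu).1
      have huC' : (⟨u, by omega⟩ : Fin (c + H.length)) ∉ C := fun h =>
        huC (Finset.mem_image.mpr ⟨_, h, rfl⟩)
      refine ⟨⟨⟨u, by omega⟩, huC'⟩, hlt, SimpleGraph.Adj.reachable ?_⟩
      rw [SimpleGraph.induce_adj, hadj]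
      refine ⟨fun h => ?_, Or.inr (mem_cliqueEdges.mpr (Or.inr ⟨by omega, hlen, hu⟩))⟩
      have := congrArg Fin.val h
      simp only at this
      omega
  have himg : (fun p : {v | v ∉ C} × {v | v ∉ C} => (p.1.val, p.2.val)) '' connectedPairs G C
      = (R.offDiag : Set (Fin (c + H.length) × Fin (c + H.length))) := by
    ext ⟨a, b⟩
    simp only [connectedPairs, Set.mem_image, Set.mem_ofPred_eq, Prod.exists, Prod.mk.injEq,
      Finset.mem_coe, Finset.mem_offDiag]
    constructor
    · rintro ⟨p, q, ⟨hpq, hr⟩, rfl, rfl⟩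
      exact ⟨hnbr p q hpq hr, hnbr q p hpq.symm hr.symm, fun h => hpq (Subtype.ext h)⟩
    · rintro ⟨ha, hb, hab⟩
      refine ⟨⟨a, ((hRmem a).mp ha).1⟩, ⟨b, ((hRmem b).mp hb).1⟩,
        ⟨fun h => hab (congrArg Subtype.val h), ?_⟩, rfl, rfl⟩
      obtain ⟨p, hp, hap⟩ := hcore ⟨a, ((hRmem a).mp ha).1⟩ ha
      obtain ⟨q, hq, hbq⟩ := hcore ⟨b, ((hRmem b).mp hb).1⟩ hb
      refine hap.trans (SimpleGraph.Reachable.trans ?_ hbq.symm)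
      by_cases hpq : p = q
      · rw [hpq]
      · apply SimpleGraph.Adj.reachable
        rw [SimpleGraph.induce_adj, hadj]
        refine ⟨fun h => hpq (Subtype.ext h), Or.inl (mem_cliqueEdges.mpr (Or.inl ⟨hp, hq, ?_⟩))⟩
        exact fun h => hpq (Subtype.ext (Fin.ext h))
  have hinj : Function.Injective
      (fun p : {v | v ∉ C} × {v | v ∉ C} => (p.1.val, p.2.val)) := by
    rintro ⟨a, b⟩ ⟨a', b'⟩ h
    simp only [Prod.mk.injEq] at h
    exact Prod.ext (Subtype.ext h.1) (Subtype.ext h.2)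
  rw [← Set.ncard_image_of_injective _ hinj, himg, Set.ncard_coe_finset, Finset.offDiag_card,
    Nat.mul_sub_one]

theorem card_add_card_isolated (C : Finset (Fin (c + H.length))) :
    C.card + (isolated c H C).card + (Cᶜ \ isolated c H C).card = c + H.length := by
  have h1 : isolated c H C ⊆ Cᶜ := by
    intro v hv
    simp only [isolated, Finset.mem_filter] at hv
    simpa using hv.2.1
  have h2 := Finset.card_sdiff_add_card_eq_card h1
  have h3 := Finset.card_add_card_compl C
  rw [Fintype.card_fin] at h3
  omega

/-- This direction allows cuts through attached vertices: a deleted vertex is never counted as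
isolated, so such deletions gain nothing. -/
theorem isolated_card_le (C : Finset (Fin (c + H.length))) :
    (isolated c H C).card ≤ inside H (C.image Fin.val) := by
  rw [inside, ← card_filter_range_getD H _ []]
  apply Finset.card_le_card_of_injOn fun v => v.val - c
  · intro v hv
    simp only [isolated, Finset.coe_filter, Finset.mem_univ, true_and, Set.mem_ofPred_eq] at hv
    simp only [Finset.coe_filter, Finset.mem_range, Set.mem_ofPred_eq, List.all_eq_true,
      decide_eq_true_eq]
    exact ⟨by omega, hv.2.2⟩
  · intro v hv w hw h
    simp only [isolated, Finset.coe_filter, Finset.mem_univ, true_and, Set.mem_ofPred_eq] at hv hw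
    simp only at h
    exact Fin.ext (by omega)

/-- Restricting the cut to the clique matters here: an attached vertex whose list is covered could
otherwise itself be deleted instead of isolated. -/
theorem inside_le_isolated_card {C : Finset (Fin (c + H.length))} (hC : ∀ v ∈ C, v.val < c) :
    inside H (C.image Fin.val) ≤ (isolated c H C).card := by
  rw [inside, ← card_filter_range_getD H _ []]
  refine le_trans (Finset.card_le_card fun i hi => ?_)
    (Finset.card_image_le (s := isolated c H C) (f := fun v => v.val - c))
  simp only [Finset.mem_filter, Finset.mem_range, List.all_eq_true, decide_eq_true_eq] at hi
  simp only [isolated, Finset.mem_image, Finset.mem_filter, Finset.mem_univ, true_and]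
  refine ⟨⟨c + i, by omega⟩, ⟨fun h => ?_, by simp, ?_⟩, by simp⟩
  · have := hC _ h
    simp at this
  · simpa using hi.2

/-- If `g` vertices remain in the big component, then `g * (g - 1) ≤ N * (N - 1)` forces `g ≤ N`,
and all vertices beyond these `g` and the at most `K` deleted ones are isolated. -/
theorem inside_of_hasCriticalNodeCut (hH : ∀ T ∈ H, ∀ u ∈ T, u < c) {K θ N : ℕ} (hc : K + 2 ≤ c)
    (hN : N = c + H.length - (K + θ))
    (h : HasCriticalNodeCut (graphOf (c + H.length) (cliqueEdges c H)) K (N * (N - 1))) :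
    ∃ S : Finset ℕ, S.card ≤ K ∧ θ ≤ inside H S := by
  obtain ⟨C, hCK, hx⟩ := h
  refine ⟨C.image Fin.val, Finset.card_image_le.trans hCK, le_trans ?_ (isolated_card_le C)⟩
  rw [connectedPairs_ncard hH] at hx
  have h1 := card_add_card_isolated C
  set g := (Cᶜ \ isolated c H C).card
  -- At least two clique vertices survive because `K + 2 ≤ c`. Since `m * (m - 1)` vanishes at both
  -- `0` and `1`, this is needed to infer `g ≤ N`; it then also rules out that the subtraction
  -- defining `N` was truncated to zero.
  have h2 : 2 ≤ g := by
    have hle : (isolated c H C).card ≤ H.length := by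
      refine (isolated_card_le C).trans ?_
      exact List.countP_le_length
    omega
  have h3 : g ≤ N := by
    by_contra hlt
    have : N * (N - 1) < g * (g - 1) := by
      calc N * (N - 1) ≤ N * (g - 1) := Nat.mul_le_mul_left _ (by omega)
        _ < g * (g - 1) := Nat.mul_lt_mul_of_pos_right (by omega) (by omega)
    omega
  omega

theorem hasCriticalNodeCut_of_inside (hH : ∀ T ∈ H, ∀ u ∈ T, u < c) {θ N : ℕ} {S : Finset ℕ}
    (hS : S ⊆ Finset.range c) (hN : N = c + H.length - (S.card + θ)) (h : θ ≤ inside H S) :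
    HasCriticalNodeCut (graphOf (c + H.length) (cliqueEdges c H)) S.card (N * (N - 1)) := by
  set C : Finset (Fin (c + H.length)) := Finset.univ.filter fun v => v.val ∈ S with hC
  have himg : C.image Fin.val = S := by
    ext u
    simp only [hC, Finset.mem_image, Finset.mem_filter, Finset.mem_univ, true_and]
    constructor
    · rintro ⟨v, hv, rfl⟩
      exact hv
    · intro hu
      have := Finset.mem_range.mp (hS hu)
      exact ⟨⟨u, by omega⟩, hu, rfl⟩
  have hcard : C.card = S.card := by
    rw [← himg, Finset.card_image_of_injective _ Fin.val_injective]
  refine ⟨C, hcard.le, ?_⟩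
  rw [connectedPairs_ncard hH]
  have h1 := card_add_card_isolated C
  have h2 := inside_le_isolated_card (C := C) fun v hv => by
    simp only [hC, Finset.mem_filter] at hv
    exact Finset.mem_range.mp (hS hv.2)
  rw [himg] at h2
  have h3 : (Cᶜ \ isolated c H C).card ≤ N := by omega
  exact Nat.mul_le_mul h3 (by omega)

end Cut

/-! ### Polynomials in set variables, and counting subsets -/

/-- Polynomials as lists of monomials, each with a sign and a list of variables. -/
abbrev SPoly : Type := List (Bool × List ℕ)

/-- Are all members of `T` in `S`? -/
def contains (S : Finset ℕ) (T : List ℕ) : Bool := T.all fun u => decide (u ∈ S)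

/-- The value of a signed monomial if exactly the variables in `S` are one, and the others zero. -/
def monoVal (S : Finset ℕ) (m : Bool × List ℕ) : ℤ :=
  (if m.1 then 1 else -1) * if contains S m.2 then 1 else 0

/-- The value of a polynomial if exactly the variables in `S` are one, and the others zero. -/
def polyVal (S : Finset ℕ) (p : SPoly) : ℤ := (p.map (monoVal S)).sum

theorem polyVal_append (S : Finset ℕ) (p q : SPoly) :
    polyVal S (p ++ q) = polyVal S p + polyVal S q := by
  simp [polyVal]

theorem polyVal_cons (S : Finset ℕ) (m : Bool × List ℕ) (p : SPoly) :
    polyVal S (m :: p) = monoVal S m + polyVal S p := by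
  simp [polyVal]

theorem polyVal_flatMap {β : Type} (S : Finset ℕ) (l : List β) (f : β → SPoly) :
    polyVal S (l.flatMap f) = (l.map fun b => polyVal S (f b)).sum := by
  induction l with
  | nil => simp [polyVal]
  | cons b l ih => simp [polyVal_append, ih]

theorem contains_append (S : Finset ℕ) (T T' : List ℕ) :
    contains S (T ++ T') = (contains S T && contains S T') := by
  simp [contains]

theorem polyVal_congr {S S' : Finset ℕ} {p : SPoly}
    (h : ∀ m ∈ p, ∀ u ∈ m.2, (u ∈ S ↔ u ∈ S')) : polyVal S p = polyVal S' p := by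
  unfold polyVal
  congr 1
  apply List.map_congr_left
  intro m hm
  have : contains S m.2 = contains S' m.2 := by
    rw [Bool.eq_iff_iff]
    simp only [contains, List.all_eq_true, decide_eq_true_eq]
    exact forall₂_congr fun u hu => h m hm u hu
  rw [monoVal, monoVal, this]

/-- All lists of length at most `D` over `U`. -/
def tuples (U : List ℕ) : ℕ → List (List ℕ)
  | 0 => [[]]
  | D + 1 => [] :: U.flatMap fun u => (tuples U D).map fun T => u :: T

/-- The number of lists of length at most `D` over a set with `s` elements. -/
def tupleCount (s : ℕ) : ℕ → ℕ
  | 0 => 1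
  | D + 1 => 1 + s * tupleCount s D

theorem tupleCount_mono {s s' : ℕ} (h : s ≤ s') (D : ℕ) : tupleCount s D ≤ tupleCount s' D := by
  induction D with
  | zero => exact le_rfl
  | succ D ih => exact Nat.add_le_add_left (Nat.mul_le_mul h ih) 1

theorem tupleCount_pos (s D : ℕ) : 0 < tupleCount s D := by
  cases D <;> simp [tupleCount]

/-- Strictness needs positive length, since for length zero only the empty list is counted. It is
what later excludes sets smaller than the budget. -/
theorem tupleCount_lt {s s' : ℕ} (h : s < s') (D : ℕ) :
    tupleCount s (D + 1) < tupleCount s' (D + 1) := by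
  have h1 := tupleCount_mono h.le D
  have h2 := tupleCount_pos s' D
  have h3 : s * tupleCount s D < s' * tupleCount s' D :=
    (Nat.mul_le_mul_left s h1).trans_lt (Nat.mul_lt_mul_of_pos_right h h2)
  simp only [tupleCount]
  omega

theorem mem_tuples {U : List ℕ} {D : ℕ} {T : List ℕ} :
    T ∈ tuples U D ↔ T.length ≤ D ∧ ∀ u ∈ T, u ∈ U := by
  induction D generalizing T with
  | zero => cases T <;> simp [tuples]
  | succ D ih =>
    cases T with
    | nil => simp [tuples]
    | cons t T =>
      simp only [tuples, List.mem_cons, reduceCtorEq, List.mem_flatMap, List.mem_map, ih,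
        List.cons.injEq, false_or, List.length_cons, Nat.add_le_add_iff_right, forall_eq_or_imp]
      constructor
      · rintro ⟨a, ha, b, ⟨h1, h2⟩, rfl, rfl⟩
        exact ⟨h1, ha, h2⟩
      · rintro ⟨h1, ha, h2⟩
        exact ⟨t, ha, T, ⟨h1, h2⟩, rfl, rfl⟩

theorem tuples_nodup {U : List ℕ} (hU : U.Nodup) (D : ℕ) : (tuples U D).Nodup := by
  induction D with
  | zero => simp [tuples]
  | succ D ih =>
    rw [tuples, List.nodup_cons, List.nodup_flatMap]
    refine ⟨by simp, fun u _ => ih.map fun _ _ h => (List.cons.inj h).2, ?_⟩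
    refine hU.imp fun {a b} hab => ?_
    simp only [Function.onFun, List.disjoint_left, List.mem_map]
    rintro _ ⟨T, _, rfl⟩ ⟨T', _, h⟩
    exact hab (List.cons.inj h).1.symm

/-- The tuples over `U` inside `S` are the tuples over the part of `U` in `S`, so their number
depends only on the size of that part. -/
theorem inside_tuples (U : List ℕ) (D : ℕ) (S : Finset ℕ) :
    inside (tuples U D) S = tupleCount (U.countP fun u => decide (u ∈ S)) D := by
  induction D with
  | zero => simp [inside, tuples, tupleCount]
  | succ D ih =>
    have key : ∀ V : List ℕ, (V.flatMap fun u => (tuples U D).map fun T => u :: T).countP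
        (fun T => T.all fun u => decide (u ∈ S))
          = V.countP (fun u => decide (u ∈ S)) * inside (tuples U D) S := by
      intro V
      induction V with
      | nil => simp
      | cons v V ihV =>
        rw [List.flatMap_cons, List.countP_append, ihV, List.countP_map, List.countP_cons]
        by_cases hv : v ∈ S
        · simp only [Function.comp_def, List.all_cons, hv, decide_true, Bool.true_and, if_true,
            inside]
          ring
        · simp [Function.comp_def, hv]
    rw [inside, tuples, List.countP_cons, key, ih, tupleCount]
    simp [add_comm]

/-- The multiset of those lists over `U` whose number of members inside a set is, up to a term
that depends only on the size of the set, the value of the polynomial `M`: a negative monomial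
is replaced by all other monomials. -/
def positivize (U : List ℕ) (D : ℕ) (M : SPoly) : List (List ℕ) :=
  (M.flatMap fun m => if m.1 then [m.2] else (tuples U D).filter fun T => !decide (T = m.2)) ++
    tuples U D

/-- The number of negative monomials. -/
def negCount (M : SPoly) : ℕ := M.countP fun m => !m.1

theorem inside_append (H H' : List (List ℕ)) (S : Finset ℕ) :
    inside (H ++ H') S = inside H S + inside H' S := by
  simp [inside]

/-- Without duplicates the filter removes exactly one list, so the count drops by the monomial of
`T`. This is how a negative sign is realized. -/
theorem inside_filter_ne {l : List (List ℕ)} (hl : l.Nodup) {T : List ℕ} (hT : T ∈ l)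
    (S : Finset ℕ) : (inside (l.filter fun T' => !decide (T' = T)) S : ℤ)
      = inside l S - if contains S T then 1 else 0 := by
  have h1 : (l.filter fun T' => !decide (T' = T)) = l.erase T := by
    rw [hl.erase_eq_filter]
    congr 1
    funext x
    rw [Bool.eq_iff_iff]
    simp
  have h2 : inside l S = inside (T :: l.erase T) S := (List.perm_cons_erase hT).countP_eq _
  rw [h1, h2]
  unfold inside
  rw [List.countP_cons]
  unfold contains
  push_cast
  ring

/-- Each negative monomial costs one full copy of `tuples U D`. The additional copy at the end of
`positivize` keeps the coefficient positive even if there are no negative monomials. -/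
theorem inside_positivize {U : List ℕ} (hU : U.Nodup) {D : ℕ} {M : SPoly}
    (hM : ∀ m ∈ M, m.2 ∈ tuples U D) (S : Finset ℕ) : (inside (positivize U D M) S : ℤ)
      = polyVal S M + (negCount M + 1) * tupleCount (U.countP fun u => decide (u ∈ S)) D := by
  rw [positivize, inside_append, ← inside_tuples]
  induction M with
  | nil => simp [inside, polyVal, negCount]
  | cons m M ih =>
    have ih := ih fun m' hm' => hM m' (List.mem_cons_of_mem _ hm')
    have h1 := inside_filter_ne (tuples_nodup hU D) (hM m List.mem_cons_self) S
    rw [List.flatMap_cons, inside_append, polyVal_cons]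
    obtain ⟨b, T⟩ := m
    push_cast at ih ⊢
    cases b
    · have h2 : negCount ((false, T) :: M) = negCount M + 1 := by simp [negCount]
      simp only [h2, Bool.false_eq_true, if_false, monoVal] at h1 ⊢
      rw [h1]
      push_cast
      linarith
    · have h2 : negCount ((true, T) :: M) = negCount M := by simp [negCount]
      have h3 : (inside [T] S : ℤ) = if contains S T then 1 else 0 := by
        simp [inside, contains, List.countP_cons]
      simp only [h2, if_true, monoVal, h3]
      linarith

/-! ### Choosing one of several conjunctions of constraints -/

/-- The polynomial for the family `F` of conjunctions of constraints in the variables below `n`;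
the variable `n + i` stands for the choice of the conjunction `i`. -/
def choicePoly (n : ℕ) (F : List (List SPoly)) : SPoly :=
  (List.range F.length).flatMap (fun i => (F.getD i []).flatMap fun p =>
    (p ++ [(false, [])]).map fun m => (m.1, (n + i) :: m.2)) ++
  ((List.range F.length).flatMap (fun i => [(true, [n + i]), (true, [n + i])]) ++
  (List.range F.length).flatMap fun i => (List.range F.length).map fun j => (false, [n + i, n + j]))

theorem sum_map_range (L : ℕ) (f : ℕ → ℤ) :
    ((List.range L).map f).sum = ∑ i ∈ Finset.range L, f i := by
  induction L with
  | zero => simp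
  | succ L ih => simp [List.range_succ, Finset.sum_range_succ, ih]

theorem polyVal_map_cons (S : Finset ℕ) (u : ℕ) (p : SPoly) :
    polyVal S (p.map fun m => (m.1, u :: m.2)) = (if u ∈ S then 1 else 0) * polyVal S p := by
  induction p with
  | nil => simp [polyVal]
  | cons m p ih =>
    rw [List.map_cons, polyVal_cons, polyVal_cons, ih]
    by_cases hu : u ∈ S <;> simp [monoVal, contains, hu]

/-- Appending the negative empty monomial turns `p` into `p - 1`, and prefixing `n + i` multiplies
by the selector. The two remaining blocks give `2 * a - a ^ 2 = 1 - (a - 1) ^ 2`, where `a` counts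
the selectors in `S`. -/
theorem polyVal_choicePoly (n : ℕ) (F : List (List SPoly)) (S : Finset ℕ) :
    polyVal S (choicePoly n F) =
      (∑ i ∈ Finset.range F.length, (if n + i ∈ S then 1 else 0) *
        ((F.getD i []).map fun p => polyVal S p - 1).sum) +
      (1 - (∑ i ∈ Finset.range F.length, (if n + i ∈ S then 1 else 0) - 1) ^ 2) := by
  rw [choicePoly, polyVal_append, polyVal_append, polyVal_flatMap, polyVal_flatMap,
    polyVal_flatMap, sum_map_range, sum_map_range, sum_map_range]
  congr 1
  · refine Finset.sum_congr rfl fun i _ => ?_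
    rw [polyVal_flatMap, ← List.sum_map_mul_left]
    congr 1
    apply List.map_congr_left
    intro p _
    rw [polyVal_map_cons, polyVal_append]
    congr 1
  · have h1 : ∀ i, polyVal S [(true, [n + i]), (true, [n + i])]
        = 2 * if n + i ∈ S then 1 else 0 := by
      intro i
      by_cases h : n + i ∈ S <;> simp [polyVal, monoVal, contains, h]
    have h2 : ∀ i, polyVal S ((List.range F.length).map fun j => (false, [n + i, n + j]))
        = (if n + i ∈ S then 1 else 0) * -∑ j ∈ Finset.range F.length,
          if n + j ∈ S then 1 else 0 := by
      intro i
      rw [polyVal, List.map_map, sum_map_range, ← Finset.sum_neg_distrib, Finset.mul_sum]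
      refine Finset.sum_congr rfl fun j _ => ?_
      by_cases h : n + i ∈ S <;> by_cases h' : n + j ∈ S <;> simp [monoVal, contains, h, h']
    simp only [h1, h2]
    rw [← Finset.mul_sum, ← Finset.sum_mul]
    ring

/-- The polynomial takes only the values zero and one. -/
def IsBoolean (p : SPoly) : Prop := ∀ S, polyVal S p = 0 ∨ polyVal S p = 1

theorem sum_sub_one_nonpos {F : List SPoly} (hF : ∀ p ∈ F, IsBoolean p) (S : Finset ℕ) :
    (F.map fun p => polyVal S p - 1).sum ≤ 0 := by
  induction F with
  | nil => simp
  | cons p F ih =>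
    have h1 := ih fun q hq => hF q (List.mem_cons_of_mem _ hq)
    rw [List.map_cons, List.sum_cons]
    rcases hF p List.mem_cons_self S with h | h <;> omega

theorem sum_sub_one_eq_zero {F : List SPoly} (hF : ∀ p ∈ F, IsBoolean p) {S : Finset ℕ}
    (h : (F.map fun p => polyVal S p - 1).sum = 0) : ∀ p ∈ F, polyVal S p = 1 := by
  induction F with
  | nil => simp
  | cons p F ih =>
    have hF' : ∀ q ∈ F, IsBoolean q := fun q hq => hF q (List.mem_cons_of_mem _ hq)
    have h1 := sum_sub_one_nonpos hF' S
    rw [List.map_cons, List.sum_cons] at h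
    have h2 := hF p List.mem_cons_self S
    intro q hq
    rcases List.mem_cons.mp hq with rfl | hq
    · omega
    · exact ih hF' (by omega) q hq

/-! ### Sets reaching the threshold are correct choices, and conversely. -/

section Choice

variable {n D : ℕ} {F : List (List SPoly)}

theorem getD_mem_or_eq_nil {β : Type} (l : List (List β)) (i : ℕ) :
    l.getD i [] ∈ l ∨ l.getD i [] = [] := by
  by_cases hi : i < l.length
  · left
    rw [List.getD_eq_getElem _ _ hi]
    exact List.getElem_mem hi
  · right
    exact List.getD_eq_default _ _ (by omega)

theorem choicePoly_mem_tuples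
    (hF : ∀ G ∈ F, ∀ p ∈ G, ∀ m ∈ p, m.2.length ≤ D ∧ ∀ u ∈ m.2, u < n) (hD : 1 ≤ D) :
    ∀ m ∈ choicePoly n F, m.2 ∈ tuples (List.range (n + F.length)) (D + 1) := by
  intro m hm
  rw [mem_tuples]
  simp only [choicePoly, List.mem_append, List.mem_flatMap, List.mem_map, List.mem_range] at hm
  rcases hm with ⟨i, hi, p, hp, m', hm', rfl⟩ | ⟨i, hi, hm⟩ | ⟨i, hi, j, hj, rfl⟩
  · have hm'' : m'.2.length ≤ D ∧ ∀ u ∈ m'.2, u < n := by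
      rcases hm' with hm' | hm'
      · rcases getD_mem_or_eq_nil F i with h | h
        · exact hF _ h p hp m' hm'
        · rw [h] at hp
          simp at hp
      · rw [List.mem_singleton.mp hm']
        simp
    refine ⟨by simpa using hm''.1, fun u hu => List.mem_range.mpr ?_⟩
    rcases List.mem_cons.mp hu with rfl | hu
    · omega
    · have := hm''.2 u hu; omega
  · have : m = (true, [n + i]) := by simpa using hm
    subst this
    simpa using hi
  -- Products of two selectors have degree two, which is where `1 ≤ D` is needed.
  · simp
    omega

/-- The members of the family of lists that is made from the choice polynomial. -/
def choiceSets (n D : ℕ) (F : List (List SPoly)) : List (List ℕ) :=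
  positivize (List.range (n + F.length)) (D + 1) (choicePoly n F)

/-- The number of lists inside a set of size `k + 1` that encodes a correct choice. -/
def choiceBound (n D k : ℕ) (F : List (List SPoly)) : ℕ :=
  1 + (negCount (choicePoly n F) + 1) * tupleCount (k + 1) (D + 1)

theorem lt_of_mem_choiceSets
    (hF : ∀ G ∈ F, ∀ p ∈ G, ∀ m ∈ p, m.2.length ≤ D ∧ ∀ u ∈ m.2, u < n) (hD : 1 ≤ D) :
    ∀ T ∈ choiceSets n D F, ∀ u ∈ T, u < n + F.length := by
  have key : ∀ T ∈ tuples (List.range (n + F.length)) (D + 1), ∀ u ∈ T, u < n + F.length :=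
    fun T h u hu => List.mem_range.mp ((mem_tuples.mp h).2 u hu)
  intro T hT
  simp only [choiceSets, positivize, List.mem_append, List.mem_flatMap] at hT
  rcases hT with ⟨m, hm, hT⟩ | hT
  · split_ifs at hT
    · rw [List.mem_singleton.mp hT]
      exact key _ (choicePoly_mem_tuples hF hD m hm)
    · exact key _ (List.mem_filter.mp hT).1
  · exact key _ hT

theorem countP_range_add (n L : ℕ) (S : Finset ℕ) :
    ((List.range (n + L)).countP fun u => decide (u ∈ S) : ℤ) = (S ∩ Finset.range n).card +
      ∑ i ∈ Finset.range L, (if n + i ∈ S then 1 else 0 : ℤ) := by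
  have h : ∀ N, ((List.range N).countP fun u => decide (u ∈ S) : ℤ)
      = ∑ i ∈ Finset.range N, (if i ∈ S then 1 else 0 : ℤ) := by
    intro N
    induction N with
    | zero => simp
    | succ N ih =>
      rw [List.range_succ, List.countP_append, Finset.sum_range_succ, ← ih]
      by_cases hN : N ∈ S <;> simp [hN]
  rw [h, Finset.sum_range_add]
  congr 1
  rw [Finset.sum_boole, Finset.inter_comm, Finset.filter_mem_eq_inter]

/-- The threshold is the largest value available to a set of size at most `k + 1`: the constraint
sum `P` is at most zero, the selector term at most one, and the tuple term at most its value at `k +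
1`. Reaching it makes all three bounds tight. -/
theorem exists_choice_of_inside (hB : ∀ G ∈ F, ∀ p ∈ G, IsBoolean p)
    (hF : ∀ G ∈ F, ∀ p ∈ G, ∀ m ∈ p, m.2.length ≤ D ∧ ∀ u ∈ m.2, u < n) (hD : 1 ≤ D)
    {k : ℕ} {S : Finset ℕ} (hS : S.card ≤ k + 1)
    (h : choiceBound n D k F ≤ inside (choiceSets n D F) S) :
    ∃ S' ⊆ Finset.range n, S'.card = k ∧ ∃ G ∈ F, ∀ p ∈ G, polyVal S' p = 1 := by
  have h1 := inside_positivize List.nodup_range (choicePoly_mem_tuples hF hD) S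
  have h2 := countP_range_add n F.length S
  rw [polyVal_choicePoly] at h1
  set s := (List.range (n + F.length)).countP fun u => decide (u ∈ S) with hs
  set a : ℤ := ∑ i ∈ Finset.range F.length, (if n + i ∈ S then 1 else 0 : ℤ) with ha
  have hsS : s ≤ S.card := by
    rw [hs, List.countP_eq_length_filter]
    rw [← List.toFinset_card_of_nodup (List.nodup_range.filter _)]
    apply Finset.card_le_card
    intro u
    simp
  have hnonpos : ∀ i, ((F.getD i []).map fun p => polyVal S p - 1).sum ≤ 0 := by
    intro i
    rcases getD_mem_or_eq_nil F i with h | h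
    · exact sum_sub_one_nonpos (hB _ h) S
    · rw [h]; simp
  have hterm : ∀ i ∈ Finset.range F.length, (if n + i ∈ S then 1 else 0 : ℤ) *
      ((F.getD i []).map fun p => polyVal S p - 1).sum ≤ 0 := by
    intro i _
    split_ifs
    · simpa using hnonpos i
    · simp
  have hP := Finset.sum_nonpos hterm
  set P : ℤ := ∑ i ∈ Finset.range F.length, (if n + i ∈ S then 1 else 0 : ℤ) *
      ((F.getD i []).map fun p => polyVal S p - 1).sum with hPdef
  have h3 : (choiceBound n D k F : ℤ) ≤ inside (choiceSets n D F) S := by exact_mod_cast h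
  rw [choiceSets, h1, choiceBound] at h3
  push_cast at h3
  have hmono : (tupleCount s (D + 1) : ℤ) ≤ tupleCount (k + 1) (D + 1) := by
    exact_mod_cast tupleCount_mono (hsS.trans hS) _
  set N : ℤ := (negCount (choicePoly n F) : ℤ) with hN
  have hN0 : 0 ≤ N := by positivity
  have hmul := mul_le_mul_of_nonneg_left hmono (by omega : 0 ≤ N + 1)
  have hsq := sq_nonneg (a - 1)
  -- The three bounds add up to the threshold, so there is no slack in any of them.
  have ha1 : (a - 1) ^ 2 = 0 := by linarith
  have hP0 : P = 0 := by linarith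
  have ha1 : a = 1 := by have := pow_eq_zero_iff (two_ne_zero) |>.mp ha1; omega
  -- Elements of `S` that are neither variables nor selectors do not count in `s`, so the strict
  -- growth of the tuple term rules them out too. With one selector, exactly `k` variables remain.
  have hsk : s = k + 1 := by
    by_contra hne
    have hlt := tupleCount_lt (show s < k + 1 by omega) D
    have hlt' : (tupleCount s (D + 1) : ℤ) < tupleCount (k + 1) (D + 1) := by exact_mod_cast hlt
    have := mul_lt_mul_of_pos_left hlt' (by omega : 0 < N + 1)
    linarith
  obtain ⟨i, hi, hiS⟩ : ∃ i ∈ Finset.range F.length, n + i ∈ S := by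
    by_contra hno
    push Not at hno
    have : a = 0 := Finset.sum_eq_zero fun i hi => if_neg (hno i hi)
    omega
  have hPi := (Finset.sum_eq_zero_iff_of_nonpos hterm).mp hP0 i hi
  rw [if_pos hiS, one_mul] at hPi
  have hmem : F.getD i [] ∈ F := by
    rw [List.getD_eq_getElem _ _ (Finset.mem_range.mp hi)]
    exact List.getElem_mem _
  refine ⟨S ∩ Finset.range n, Finset.inter_subset_right, by omega, _, hmem, fun p hp => ?_⟩
  rw [← sum_sub_one_eq_zero (hB _ hmem) hPi p hp]
  apply polyVal_congr
  intro m hm u hu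
  simp [(hF _ hmem p hp m hm).2 u hu]

theorem exists_inside_of_choice
    (hF : ∀ G ∈ F, ∀ p ∈ G, ∀ m ∈ p, m.2.length ≤ D ∧ ∀ u ∈ m.2, u < n) (hD : 1 ≤ D)
    {S' : Finset ℕ} (hS' : S' ⊆ Finset.range n) {G : List SPoly} (hG : G ∈ F)
    (hp : ∀ p ∈ G, polyVal S' p = 1) :
    ∃ S ⊆ Finset.range (n + F.length), S.card = S'.card + 1 ∧
      choiceBound n D S'.card F ≤ inside (choiceSets n D F) S := by
  obtain ⟨i, hi, rfl⟩ := List.mem_iff_getElem.mp hG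
  have hni : n + i ∉ S' := fun h => by have := Finset.mem_range.mp (hS' h); omega
  refine ⟨insert (n + i) S', ?_, Finset.card_insert_of_notMem hni, ?_⟩
  · intro u hu
    rw [Finset.mem_range]
    rcases Finset.mem_insert.mp hu with rfl | hu
    · omega
    · have := Finset.mem_range.mp (hS' hu); omega
  set S := insert (n + i) S' with hS
  have hmem : ∀ j, n + j ∈ S ↔ j = i := by
    intro j
    rw [hS, Finset.mem_insert]
    constructor
    · rintro (h | h)
      · omega
      · have := Finset.mem_range.mp (hS' h); omega
    · rintro rfl
      exact Or.inl rfl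
  have h1 := inside_positivize List.nodup_range (choicePoly_mem_tuples hF hD) S
  have h2 := countP_range_add n F.length S
  rw [polyVal_choicePoly] at h1
  have ha : ∑ j ∈ Finset.range F.length, (if n + j ∈ S then 1 else 0 : ℤ) = 1 := by
    simp only [hmem]
    rw [Finset.sum_ite_eq' (Finset.range F.length) i]
    simp [hi]
  have hP : ∑ j ∈ Finset.range F.length, (if n + j ∈ S then 1 else 0 : ℤ) *
      ((F.getD j []).map fun p => polyVal S p - 1).sum = 0 := by
    apply Finset.sum_eq_zero
    intro j _
    by_cases hj : j = i
    · subst hj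
      rw [List.getD_eq_getElem _ _ hi]
      apply mul_eq_zero_of_right
      apply List.sum_eq_zero
      intro x hx
      obtain ⟨p, hpG, rfl⟩ := List.mem_map.mp hx
      rw [sub_eq_zero, ← hp p hpG]
      apply polyVal_congr
      intro m hm u hu
      have := (hF _ hG p hpG m hm).2 u hu
      rw [hS, Finset.mem_insert]
      exact ⟨fun h => h.resolve_left (by omega), Or.inr⟩
    · rw [if_neg (by rwa [hmem]), zero_mul]
  have hSn : S ∩ Finset.range n = S' := by
    ext u
    rw [Finset.mem_inter, hS, Finset.mem_insert, Finset.mem_range]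
    constructor
    · rintro ⟨rfl | h, hu⟩
      · omega
      · exact h
    · exact fun h => ⟨Or.inr h, Finset.mem_range.mp (hS' h)⟩
  rw [ha, hSn] at h2
  rw [ha, hP] at h1
  have hcount : ((List.range (n + F.length)).countP fun u => decide (u ∈ S)) = S'.card + 1 := by
    exact_mod_cast h2
  rw [hcount] at h1
  zify
  rw [choiceSets, h1, choiceBound]
  push_cast
  linarith

end Choice

/-! ### Nodes of circuits -/

namespace Gate

/-- The kind of a node. -/
def tag : Gate → ℕ
  | inp _ => 0
  | not _ => 1
  | and _ => 2
  | or _ => 3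

/-- The variable of an input node. -/
def var : Gate → ℕ
  | inp i => i
  | _ => 0

/-- Does the gate negate its inputs, when viewed as a possibly negated conjunction? -/
def negIn (g : Gate) : Bool := decide (g.tag = 3)

/-- Does the gate negate its output, when viewed as a possibly negated conjunction? -/
def negOut (g : Gate) : Bool := !decide (g.tag = 2)

theorem eq_inp_of_tag {g : Gate} (h : g.tag = 0) : g = inp g.var := by
  cases g <;> simp_all [tag, var]

theorem value_inp (S : Finset ℕ) (vs : List Bool) {g : Gate} (h : g.tag = 0) :
    g.value S vs = decide (g.var ∈ S) := by
  rw [eq_inp_of_tag h]; rfl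

/-- By De Morgan every gate is a conjunction with uniformly negated or unnegated inputs and output,
so later inductions treat all gate types at once. -/
theorem value_gate (S : Finset ℕ) (vs : List Bool) {g : Gate} (h : g.tag ≠ 0) :
    g.value S vs = (g.negOut ^^ g.preds.all fun j => g.negIn ^^ vs.getD j false) := by
  cases g with
  | inp i => exact absurd rfl h
  | not j => simp [value, negOut, negIn, tag, preds]
  | and js => simp [value, negOut, negIn, tag, preds]
  | or js =>
    have : ∀ l : List ℕ, (l.any fun j => vs.getD j false)
        = !l.all fun j => true ^^ vs.getD j false := by
      intro l
      induction l with
      | nil => rfl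
      | cons j l ih => rw [List.any_cons, List.all_cons, ih]; cases vs.getD j false <;> simp
    simpa [value, negOut, negIn, tag, preds] using this js

theorem depth_inp (ds : List ℕ) {g : Gate} (h : g.tag = 0) : g.depth ds = 0 := by
  rw [eq_inp_of_tag h]; rfl

theorem foldr_max_le {l : List ℕ} {f : ℕ → ℕ} {d : ℕ} :
    (l.map f).foldr max 0 ≤ d ↔ ∀ i ∈ l, f i ≤ d := by
  induction l with
  | nil => simp
  | cons a l ih => simp [ih]

theorem depth_gate_le (ds : List ℕ) {g : Gate} (h : g.tag ≠ 0) {d : ℕ} :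
    g.depth ds ≤ d ↔ 0 < d ∧ ∀ j ∈ g.preds, ds.getD j 0 ≤ d - 1 := by
  have : g.depth ds = (g.preds.map fun j => ds.getD j 0).foldr max 0 + 1 := by
    cases g with
    | inp i => exact absurd rfl h
    | _ => rfl
  rw [this, ← foldr_max_le]
  omega

theorem weft_le (ws : List ℕ) {g : Gate} {w : ℕ} :
    g.weft ws ≤ w ↔ if 2 < g.preds.length then 0 < w ∧ ∀ j ∈ g.preds, ws.getD j 0 ≤ w - 1
      else ∀ j ∈ g.preds, ws.getD j 0 ≤ w := by
  by_cases h : 2 < g.preds.length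
  · rw [weft, if_pos (show g.IsLarge from h), if_pos h, ← foldr_max_le]; omega
  · rw [weft, if_neg (show ¬ g.IsLarge from h), if_neg h, ← foldr_max_le, add_zero]

theorem value_congr (S : Finset ℕ) {vs vs' : List Bool} {g : Gate}
    (h : ∀ j ∈ g.preds, vs.getD j false = vs'.getD j false) : g.value S vs = g.value S vs' := by
  by_cases hg : g.tag = 0
  · rw [value_inp _ _ hg, value_inp _ _ hg]
  · rw [value_gate _ _ hg, value_gate _ _ hg]
    congr 1
    rw [Bool.eq_iff_iff]
    simp only [List.all_eq_true]
    exact forall₂_congr fun j hj => by rw [h j hj]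

theorem map_congr_preds {ds ds' : List ℕ} {g : Gate}
    (h : ∀ j ∈ g.preds, ds.getD j 0 = ds'.getD j 0) :
    (g.preds.map fun j => ds.getD j 0) = g.preds.map fun j => ds'.getD j 0 :=
  List.map_congr_left h

theorem depth_congr {ds ds' : List ℕ} {g : Gate}
    (h : ∀ j ∈ g.preds, ds.getD j 0 = ds'.getD j 0) : g.depth ds = g.depth ds' := by
  have := map_congr_preds h
  cases g with
  | inp i => rfl
  | _ => simp only [depth]; rw [this]

theorem weft_congr {ds ds' : List ℕ} {g : Gate}
    (h : ∀ j ∈ g.preds, ds.getD j 0 = ds'.getD j 0) : g.weft ds = g.weft ds' := by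
  unfold weft
  rw [map_congr_preds h]

end Gate

/-- The node with number `j`. -/
def gateAt (gs : List Gate) (j : ℕ) : Gate := gs.getD j (Gate.and [])

/-- The default of `gateAt` is an empty conjunction and not an input node, so tag zero already shows
that the index is in range. -/
theorem inp_mem_of_gateAt {gs : List Gate} {j : ℕ} (h : (gateAt gs j).tag = 0) :
    Gate.inp (gateAt gs j).var ∈ gs := by
  by_cases hj : j < gs.length
  · rw [← Gate.eq_inp_of_tag h, gateAt, List.getD_eq_getElem _ _ hj]
    exact List.getElem_mem hj
  · rw [gateAt, List.getD_eq_default _ _ (by omega)] at h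
    simp [Gate.tag] at h

/-! ### Values, depth and weft of single nodes. -/

namespace Circuit

section Run

variable {β : Type} (step : List β → Gate → β)

theorem run_append (gs : List Gate) (g : Gate) :
    run step (gs ++ [g]) = run step gs ++ [step (run step gs) g] := by
  simp [run]

theorem length_run (gs : List Gate) : (run step gs).length = gs.length := by
  induction gs using List.reverseRecOn with
  | nil => rfl
  | append_singleton gs g ih => simp [run_append, ih]

/-- The result for a node is computed from the results for the nodes that feed it. -/
theorem run_getD {d : β} (hstep : ∀ vs vs' g, (∀ j ∈ Gate.preds g, vs.getD j d = vs'.getD j d) →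
    step vs g = step vs' g) {gs : List Gate}
    (hgs : ∀ (i : ℕ) (g : Gate), gs[i]? = some g → ∀ j ∈ g.preds, j < i) :
    ∀ i < gs.length, (run step gs).getD i d = step (run step gs) (gateAt gs i) := by
  induction gs using List.reverseRecOn with
  | nil => simp
  | append_singleton gs g ih =>
    intro i hi
    have hpre : ∀ (i : ℕ) (g' : Gate), gs[i]? = some g' → ∀ j ∈ g'.preds, j < i := by
      intro i g' h
      obtain ⟨hlt, -⟩ := List.getElem?_eq_some_iff.mp h
      exact hgs i g' (by rw [List.getElem?_append_left hlt, h])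
    have hlen := length_run step gs
    -- Appending a result does not change what a node reads from the earlier positions.
    have hcongr : ∀ g' : Gate, (∀ j ∈ g'.preds, j < gs.length) →
        step (run step gs) g' = step (run step gs ++ [step (run step gs) g]) g' := by
      intro g' h
      apply hstep
      intro j hj
      rw [List.getD_append _ _ _ _ (by rw [hlen]; exact h j hj)]
    rw [run_append]
    by_cases h : i < gs.length
    · rw [List.getD_append _ _ _ _ (by omega), ih hpre i h]
      have hg : gateAt (gs ++ [g]) i = gateAt gs i := List.getD_append _ _ _ _ h
      rw [hg]
      apply hcongr
      intro j hj
      refine (hpre i (gateAt gs i) ?_ j hj).trans h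
      rw [gateAt, List.getD_eq_getElem _ _ h, List.getElem?_eq_getElem h]
    · have hi' : i = gs.length := by
        rw [List.length_append, List.length_singleton] at hi; omega
      subst hi'
      have hg : gateAt (gs ++ [g]) gs.length = g := by simp [gateAt]
      rw [hg, ← hcongr g (hgs gs.length g (by simp))]
      rw [← hlen]
      simp

end Run

/-- The value of the node `j`. -/
def nodeVal (gs : List Gate) (S : Finset ℕ) (j : ℕ) : Bool :=
  (run (Gate.value S) gs).getD j false

/-- The depth of the node `j`. -/
def nodeDepth (gs : List Gate) (j : ℕ) : ℕ := (run Gate.depth gs).getD j 0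

/-- The weft of the node `j`. -/
def nodeWeft (gs : List Gate) (j : ℕ) : ℕ := (run Gate.weft gs).getD j 0

theorem getLastD_eq_getD {β : Type} (l : List β) (d : β) :
    l.getLastD d = l.getD (l.length - 1) d := by
  rw [List.getLastD_eq_getLast?, List.getLast?_eq_getElem?, List.getD_eq_getElem?_getD]

theorem eval_eq (C : Circuit) (S : Finset ℕ) :
    C.eval S = nodeVal C.gates S (C.gates.length - 1) := by
  rw [eval, getLastD_eq_getD, length_run]; rfl

theorem depth_eq (C : Circuit) : C.depth = nodeDepth C.gates (C.gates.length - 1) := by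
  rw [depth, getLastD_eq_getD, length_run]; rfl

theorem weft_eq (C : Circuit) : C.weft = nodeWeft C.gates (C.gates.length - 1) := by
  rw [weft, getLastD_eq_getD, length_run]; rfl

/-- Nodes are fed by earlier nodes only. -/
def Ordered (gs : List Gate) : Prop :=
  ∀ (i : ℕ) (g : Gate), gs[i]? = some g → ∀ j ∈ g.preds, j < i

theorem pred_lt {gs : List Gate} (hgs : Ordered gs) {j : ℕ} (hj : j < gs.length)
    {i : ℕ} (hi : i ∈ (gateAt gs j).preds) : i < gs.length :=
  (hgs j (gateAt gs j) (by
    rw [gateAt, List.getD_eq_getElem _ _ hj, List.getElem?_eq_getElem hj]) i hi).trans hj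

theorem nodeVal_inp {gs : List Gate} (hgs : Ordered gs) {j : ℕ} (hj : j < gs.length)
    (S : Finset ℕ) (h : (gateAt gs j).tag = 0) :
    nodeVal gs S j = decide ((gateAt gs j).var ∈ S) := by
  rw [nodeVal, run_getD _ (fun _ _ _ => Gate.value_congr S) hgs j hj, Gate.value_inp _ _ h]

theorem nodeVal_gate {gs : List Gate} (hgs : Ordered gs) {j : ℕ} (hj : j < gs.length)
    (S : Finset ℕ) (h : (gateAt gs j).tag ≠ 0) :
    nodeVal gs S j = ((gateAt gs j).negOut ^^
      (gateAt gs j).preds.all fun i => (gateAt gs j).negIn ^^ nodeVal gs S i) := by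
  rw [nodeVal, run_getD _ (fun _ _ _ => Gate.value_congr S) hgs j hj, Gate.value_gate _ _ h]
  rfl

theorem nodeDepth_inp {gs : List Gate} (hgs : Ordered gs) {j : ℕ} (hj : j < gs.length)
    (h : (gateAt gs j).tag = 0) : nodeDepth gs j = 0 := by
  rw [nodeDepth, run_getD _ (fun _ _ _ => Gate.depth_congr) hgs j hj, Gate.depth_inp _ h]

theorem nodeDepth_gate_le {gs : List Gate} (hgs : Ordered gs) {j : ℕ} (hj : j < gs.length)
    (h : (gateAt gs j).tag ≠ 0) {d : ℕ} :
    nodeDepth gs j ≤ d ↔ 0 < d ∧ ∀ i ∈ (gateAt gs j).preds, nodeDepth gs i ≤ d - 1 := by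
  rw [nodeDepth, run_getD _ (fun _ _ _ => Gate.depth_congr) hgs j hj, Gate.depth_gate_le _ h]
  rfl

theorem nodeWeft_le {gs : List Gate} (hgs : Ordered gs) {j : ℕ} (hj : j < gs.length)
    {w : ℕ} : nodeWeft gs j ≤ w ↔ if 2 < (gateAt gs j).preds.length then
    0 < w ∧ ∀ i ∈ (gateAt gs j).preds, nodeWeft gs i ≤ w - 1
      else ∀ i ∈ (gateAt gs j).preds, nodeWeft gs i ≤ w := by
  rw [nodeWeft, run_getD _ (fun _ _ _ => Gate.weft_congr) hgs j hj, Gate.weft_le]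
  rfl

end Circuit

open Circuit

/-! ### Checking circuits -/

/-- Has the node `j` depth at most `d` and weft at most `w`? -/
def smallNode (gs : List Gate) : ℕ → ℕ → ℕ → Bool
  | 0, _, j => decide ((gateAt gs j).tag = 0)
  | d + 1, w, j =>
    if decide ((gateAt gs j).tag = 0) then true
    else if decide (2 < (gateAt gs j).preds.length) then
      decide (0 < w) && (gateAt gs j).preds.all fun i => smallNode gs d (w - 1) i
    else (gateAt gs j).preds.all fun i => smallNode gs d w i

/-- A gate fits the budgets iff its inputs fit the depth budget lowered by one and, below a large
gate, also the weft budget lowered by one. The recursion depth `d` is constant in the reduction,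
which keeps this test polynomial. -/
theorem smallNode_iff {gs : List Gate} (hgs : Ordered gs) (d : ℕ) :
    ∀ (w j : ℕ), j < gs.length →
      (smallNode gs d w j = true ↔ nodeDepth gs j ≤ d ∧ nodeWeft gs j ≤ w) := by
  have hinp : ∀ (d w j : ℕ), j < gs.length → (gateAt gs j).tag = 0 →
      nodeDepth gs j ≤ d ∧ nodeWeft gs j ≤ w := by
    intro d w j hj h
    have hp : (gateAt gs j).preds = [] := by rw [Gate.eq_inp_of_tag h]; rfl
    refine ⟨by rw [nodeDepth_inp hgs hj h]; omega, ?_⟩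
    rw [nodeWeft_le hgs hj, hp]
    simp
  induction d with
  | zero =>
    intro w j hj
    rw [smallNode, decide_eq_true_eq]
    refine ⟨hinp 0 w j hj, fun h => ?_⟩
    by_contra h'
    exact absurd ((nodeDepth_gate_le hgs hj h').mp h.1).1 (by omega)
  | succ d ih =>
    intro w j hj
    rw [smallNode]
    by_cases h : (gateAt gs j).tag = 0
    · simpa [h] using hinp (d + 1) w j hj h
    · have hlt := fun i hi => pred_lt hgs hj (i := i) hi
      rw [nodeDepth_gate_le hgs hj h, nodeWeft_le hgs hj]
      simp only [h, decide_false, Bool.false_eq_true, if_false, decide_eq_true_eq, Nat.zero_lt_succ,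
        true_and, Nat.add_sub_cancel]
      split_ifs
      · rw [Bool.and_eq_true, decide_eq_true_eq, List.all_eq_true,
          forall₂_congr fun i hi => ih (w - 1) i (hlt i hi)]
        simp only [forall_and]
        tauto
      · rw [List.all_eq_true, forall₂_congr fun i hi => ih w i (hlt i hi)]
        simp only [forall_and]

/-- Is the circuit well-formed? -/
def isWellFormed (C : Circuit) : Bool :=
  !C.gates.isEmpty && ((List.range C.gates.length).all (fun i =>
    (gateAt C.gates i).preds.all fun j => decide (j < i)) &&
    C.gates.all fun g => !decide (g.tag = 0) || decide (g.var < C.inputs))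

theorem isWellFormed_iff (C : Circuit) : isWellFormed C = true ↔ C.WellFormed := by
  simp only [isWellFormed, WellFormed, Bool.and_eq_true, List.all_eq_true, decide_eq_true_eq,
    List.mem_range]
  refine and_congr (by simp) (and_congr ?_ ?_)
  · constructor
    · intro h i g hg j hj
      obtain ⟨hi, hg'⟩ := List.getElem?_eq_some_iff.mp hg
      refine h i hi j ?_
      rwa [gateAt, List.getD_eq_getElem _ _ hi, hg']
    · intro h i hi j hj
      exact h i (gateAt C.gates i) (by
        rw [gateAt, List.getD_eq_getElem _ _ hi, List.getElem?_eq_getElem hi]) j hj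
  · constructor
    · intro h i hi
      have := h _ hi
      simp only [Gate.tag, decide_true, Bool.not_true, Bool.false_or, decide_eq_true_eq] at this
      exact this
    · intro h g hg
      by_cases hg0 : g.tag = 0
      · rw [Gate.eq_inp_of_tag hg0] at hg
        simpa [hg0] using h _ hg
      · simp [hg0]

/-! ### Polynomials for nodes of weft zero -/

/-- One minus the given polynomial. -/
def complPoly (p : SPoly) : SPoly := (true, []) :: p.map fun m => (!m.1, m.2)

/-- The product of polynomials. -/
def mulPoly (p q : SPoly) : SPoly := p.flatMap fun m => q.map fun m' => (!(m.1 ^^ m'.1), m.2 ++ m'.2)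

/-- The given polynomial, or one minus it. -/
def xorPoly (b : Bool) (p : SPoly) : SPoly := if b then complPoly p else p

theorem polyVal_complPoly (S : Finset ℕ) (p : SPoly) : polyVal S (complPoly p) = 1 - polyVal S p := by
  have : polyVal S (p.map fun m => (!m.1, m.2)) = -polyVal S p := by
    induction p with
    | nil => simp [polyVal]
    | cons m p ih =>
      rw [List.map_cons, polyVal_cons, polyVal_cons, ih]
      obtain ⟨b, T⟩ := m
      have : ∀ e : ℤ, (if contains S T = true then -e else 0) = -if contains S T = true then e else 0 := by
        intro e; split_ifs <;> simp
      cases b <;> simp [monoVal, this] <;> ring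
  rw [complPoly, polyVal_cons, this]
  simp [monoVal, contains]
  ring

/-- Containment of a concatenation is the conjunction of containments, so repeated variables in a
monomial are harmless. -/
theorem polyVal_mulPoly (S : Finset ℕ) (p q : SPoly) :
    polyVal S (mulPoly p q) = polyVal S p * polyVal S q := by
  have h : ∀ m : Bool × List ℕ, polyVal S (q.map fun m' => (!(m.1 ^^ m'.1), m.2 ++ m'.2))
      = monoVal S m * polyVal S q := by
    rintro ⟨b, T⟩
    induction q with
    | nil => simp [polyVal]
    | cons m q ih =>
      rw [List.map_cons, polyVal_cons, polyVal_cons, ih, mul_add]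
      obtain ⟨b', T'⟩ := m
      congr 1
      simp only [monoVal, contains_append]
      cases b <;> cases b' <;> cases contains S T <;> cases contains S T' <;> simp
  rw [mulPoly, polyVal_flatMap]
  simp only [h]
  induction p with
  | nil => simp [polyVal]
  | cons m p ih => rw [List.map_cons, List.sum_cons, ih, polyVal_cons, add_mul]

theorem polyVal_one (S : Finset ℕ) : polyVal S [(true, [])] = 1 := by
  simp [polyVal, monoVal, contains]

theorem polyVal_var (S : Finset ℕ) (i : ℕ) :
    polyVal S [(true, [i])] = if decide (i ∈ S) then 1 else 0 := by
  simp [polyVal, monoVal, contains]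

theorem polyVal_xorPoly {S : Finset ℕ} {p : SPoly} {v : Bool} (b : Bool)
    (h : polyVal S p = if v then 1 else 0) :
    polyVal S (xorPoly b p) = if b ^^ v then 1 else 0 := by
  cases b
  · simpa [xorPoly] using h
  · rw [xorPoly, if_pos rfl, polyVal_complPoly, h]
    cases v <;> simp

/-- All monomials have degree at most `D` and only variables of the nodes `gs`. -/
def PolyIn (gs : List Gate) (D : ℕ) (p : SPoly) : Prop :=
  ∀ m ∈ p, m.2.length ≤ D ∧ ∀ u ∈ m.2, Gate.inp u ∈ gs

section PolyIn

variable {gs : List Gate} {D D' : ℕ} {p q : SPoly}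

theorem PolyIn.mono (h : PolyIn gs D p) (hD : D ≤ D') : PolyIn gs D' p :=
  fun m hm => ⟨(h m hm).1.trans hD, (h m hm).2⟩

theorem PolyIn.one : PolyIn gs D [(true, [])] := by
  intro m hm
  rw [List.mem_singleton.mp hm]
  simp

theorem PolyIn.var {j : ℕ} (h : (gateAt gs j).tag = 0) (hD : 1 ≤ D) :
    PolyIn gs D [(true, [(gateAt gs j).var])] := by
  intro m hm
  rw [List.mem_singleton.mp hm]
  simpa using ⟨hD, inp_mem_of_gateAt h⟩

theorem PolyIn.xorPoly (h : PolyIn gs D p) (b : Bool) : PolyIn gs D (xorPoly b p) := by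
  cases b
  · exact h
  · intro m hm
    rcases List.mem_cons.mp hm with rfl | hm
    · simp
    · obtain ⟨m', hm', rfl⟩ := List.mem_map.mp hm
      exact h m' hm'

theorem PolyIn.mulPoly (hp : PolyIn gs D p) (hq : PolyIn gs D' q) :
    PolyIn gs (D + D') (mulPoly p q) := by
  intro m hm
  simp only [ParamComplexity.mulPoly, List.mem_flatMap, List.mem_map] at hm
  obtain ⟨a, ha, b, hb, rfl⟩ := hm
  have h1 := hp a ha
  have h2 := hq b hb
  refine ⟨by rw [List.length_append]; omega, fun u hu => ?_⟩
  exact (List.mem_append.mp hu).elim (h1.2 u) (h2.2 u)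

end PolyIn

/-- The polynomial for the value of the node `j`, if it has depth at most `d` and no large gates. -/
def nodePoly (gs : List Gate) : ℕ → ℕ → SPoly
  | 0, j => if decide ((gateAt gs j).tag = 0) then [(true, [(gateAt gs j).var])] else []
  | d + 1, j =>
    if decide ((gateAt gs j).tag = 0) then [(true, [(gateAt gs j).var])]
    else xorPoly (gateAt gs j).negOut (mulPoly
      (if (gateAt gs j).preds.isEmpty then [(true, [])]
        else xorPoly (gateAt gs j).negIn (nodePoly gs d ((gateAt gs j).preds.headD 0)))
      (if (gateAt gs j).preds.tail.isEmpty then [(true, [])]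
        else xorPoly (gateAt gs j).negIn (nodePoly gs d ((gateAt gs j).preds.tail.headD 0))))

/-- `nodePoly` multiplies at most two polynomials per level, so the degree bound doubles. -/
theorem nodePoly_polyIn (gs : List Gate) (d : ℕ) : ∀ j, PolyIn gs (2 ^ d) (nodePoly gs d j) := by
  induction d with
  | zero =>
    intro j
    rw [nodePoly]
    split_ifs with h
    · exact PolyIn.var (by simpa using h) (by simp)
    · intro m hm
      simp at hm
  | succ d ih =>
    intro j
    rw [nodePoly]
    split_ifs with h <;>
    first
    | exact PolyIn.var (by simpa using h) Nat.one_le_two_pow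
    | rw [pow_succ, mul_two]
      refine PolyIn.xorPoly (PolyIn.mulPoly ?_ ?_) _ <;>
        first
        | exact PolyIn.one
        | exact (ih _).xorPoly _

theorem polyVal_nodePoly {gs : List Gate} (hgs : Ordered gs) (S : Finset ℕ) (d : ℕ) :
    ∀ j < gs.length, nodeDepth gs j ≤ d → nodeWeft gs j ≤ 0 →
      polyVal S (nodePoly gs d j) = if nodeVal gs S j then 1 else 0 := by
  induction d with
  | zero =>
    intro j hj hd _
    have h : (gateAt gs j).tag = 0 := by
      by_contra h
      exact absurd ((nodeDepth_gate_le hgs hj h).mp hd).1 (by omega)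
    rw [nodePoly, if_pos (by simpa using h), polyVal_var, nodeVal_inp hgs hj S h]
  | succ d ih =>
    intro j hj hd hw
    rw [nodePoly]
    by_cases h : (gateAt gs j).tag = 0
    · rw [if_pos (by simpa using h), polyVal_var, nodeVal_inp hgs hj S h]
    · rw [if_neg (by simpa using h), nodeVal_gate hgs hj S h]
      have hd' := ((nodeDepth_gate_le hgs hj h).mp hd).2
      have hw' := (nodeWeft_le hgs hj).mp hw
      have hlt := fun i hi => pred_lt hgs hj (i := i) hi
      split_ifs at hw' with hlarge
      -- Weft zero excludes large gates, so the two inputs read by `nodePoly` are all there are.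
      · exact absurd hw'.1 (by omega)
      have hv : ∀ i ∈ (gateAt gs j).preds, polyVal S (xorPoly (gateAt gs j).negIn (nodePoly gs d i))
          = if (gateAt gs j).negIn ^^ nodeVal gs S i then 1 else 0 :=
        fun i hi => polyVal_xorPoly _ (ih i (hlt i hi) (hd' i hi) (hw' i hi))
      apply polyVal_xorPoly
      rw [polyVal_mulPoly]
      match hl : (gateAt gs j).preds with
      | [] => simp [polyVal_one]
      | [a] =>
        rw [hl] at hv
        simp [polyVal_one, hv a]
      | [a, b] =>
        rw [hl] at hv
        simp only [List.isEmpty_cons, List.tail_cons, Bool.false_eq_true, if_false,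
          List.headD_cons, hv a (by simp), hv b (by simp), List.all_cons, List.all_nil]
        have hmul : ∀ x y : Bool, ((if x then 1 else 0) * (if y then 1 else 0) : ℤ)
            = if x && (y && true) then 1 else 0 := by decide
        exact hmul _ _
      | a :: b :: e :: l =>
        rw [hl] at hlarge
        simp at hlarge

/-! ### Nondeterministic evaluation of nodes of weft one -/

/-- Conjunctions of constraints, at least one of which holds if and only if the node `j` of depth
at most `d` and weft at most one has the value `b`. -/
def guesses (gs : List Gate) : ℕ → ℕ → Bool → List (List SPoly)
  | 0, j, b =>
    if decide ((gateAt gs j).tag = 0) then [[xorPoly (!b) [(true, [(gateAt gs j).var])]]] else []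
  | d + 1, j, b =>
    if decide ((gateAt gs j).tag = 0) then [[xorPoly (!b) [(true, [(gateAt gs j).var])]]]
    else if decide (2 < (gateAt gs j).preds.length) then
      if b ^^ (gateAt gs j).negOut then
        [(gateAt gs j).preds.map fun i => xorPoly (gateAt gs j).negIn (nodePoly gs d i)]
      else (gateAt gs j).preds.map fun i => [xorPoly (!(gateAt gs j).negIn) (nodePoly gs d i)]
    else
      if b ^^ (gateAt gs j).negOut then
        (if (gateAt gs j).preds.isEmpty then [[]]
          else guesses gs d ((gateAt gs j).preds.headD 0) (!(gateAt gs j).negIn)).flatMap fun G =>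
        (if (gateAt gs j).preds.tail.isEmpty then [[]]
          else guesses gs d ((gateAt gs j).preds.tail.headD 0) (!(gateAt gs j).negIn)).map
            fun G' => G ++ G'
      else (gateAt gs j).preds.flatMap fun i => guesses gs d i (gateAt gs j).negIn

theorem guesses_polyIn (gs : List Gate) (d : ℕ) :
    ∀ j b, ∀ G ∈ guesses gs d j b, ∀ p ∈ G, PolyIn gs (2 ^ d) p := by
  have hvar : ∀ (d j : ℕ) (b : Bool), decide ((gateAt gs j).tag = 0) = true →
      ∀ G ∈ [[xorPoly (!b) [(true, [(gateAt gs j).var])]]], ∀ p ∈ G, PolyIn gs (2 ^ d) p := by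
    intro d j b h G hG p hp
    rw [List.mem_singleton.mp hG, List.mem_singleton] at hp
    rw [hp]
    exact (PolyIn.var (by simpa using h) Nat.one_le_two_pow).xorPoly _
  induction d with
  | zero =>
    intro j b
    rw [guesses]
    split_ifs with h
    · exact hvar 0 j b h
    · simp
  | succ d ih =>
    intro j b
    have hpow : 2 ^ d ≤ 2 ^ (d + 1) := Nat.pow_le_pow_right (by omega) (by omega)
    have hbr : ∀ (l : List ℕ) (b' : Bool),
        ∀ G ∈ (if l.isEmpty then [[]] else guesses gs d (l.headD 0) b'), ∀ p ∈ G,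
          PolyIn gs (2 ^ d) p := by
      intro l b' G hG
      split_ifs at hG
      · rw [List.mem_singleton.mp hG]; simp
      · exact ih _ _ G hG
    rw [guesses]
    intro G hG p hp
    by_cases h : decide ((gateAt gs j).tag = 0) = true
    · rw [if_pos h] at hG
      exact hvar (d + 1) j b h G hG p hp
    rw [if_neg h] at hG
    by_cases hlarge : decide (2 < (gateAt gs j).preds.length) = true <;>
      by_cases hbo : (b ^^ (gateAt gs j).negOut) = true <;>
      simp only [hlarge, hbo, if_true, if_false, Bool.false_eq_true] at hG
    · rw [List.mem_singleton.mp hG] at hp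
      obtain ⟨i, _, rfl⟩ := List.mem_map.mp hp
      exact ((nodePoly_polyIn gs d i).xorPoly _).mono hpow
    · obtain ⟨i, _, rfl⟩ := List.mem_map.mp hG
      rw [List.mem_singleton.mp hp]
      exact ((nodePoly_polyIn gs d i).xorPoly _).mono hpow
    · obtain ⟨G1, hG1, hG⟩ := List.mem_flatMap.mp hG
      obtain ⟨G2, hG2, rfl⟩ := List.mem_map.mp hG
      exact ((List.mem_append.mp hp).elim (hbr _ _ G1 hG1 p) (hbr _ _ G2 hG2 p)).mono hpow
    · obtain ⟨i, _, hG⟩ := List.mem_flatMap.mp hG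
      exact (ih _ _ G hG p hp).mono hpow

theorem isBoolean_of_polyVal {p : SPoly} (v : Finset ℕ → Bool)
    (h : ∀ S, polyVal S p = if v S then 1 else 0) : IsBoolean p := by
  intro S
  rw [h S]
  split_ifs <;> simp

/-- The choice argument needs `p - 1 ≤ 0` at every assignment. The weft bound ensures that
`nodePoly` is applied only where it computes a node value. -/
theorem guesses_isBoolean {gs : List Gate} (hgs : Ordered gs) (d : ℕ) :
    ∀ j b, j < gs.length → nodeDepth gs j ≤ d → nodeWeft gs j ≤ 1 →
      ∀ G ∈ guesses gs d j b, ∀ p ∈ G, IsBoolean p := by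
  have hvar : ∀ (j : ℕ) (b : Bool),
      ∀ G ∈ [[xorPoly (!b) [(true, [(gateAt gs j).var])]]], ∀ p ∈ G, IsBoolean p := by
    intro j b G hG p hp
    rw [List.mem_singleton.mp hG, List.mem_singleton] at hp
    rw [hp]
    exact isBoolean_of_polyVal _ fun S => polyVal_xorPoly _ (polyVal_var S _)
  induction d with
  | zero =>
    intro j b _ _ _
    rw [guesses]
    split_ifs
    · exact hvar j b
    · simp
  | succ d ih =>
    intro j b hj hd hw G hG p hp
    rw [guesses] at hG
    by_cases h : (gateAt gs j).tag = 0
    · rw [if_pos (by simpa using h)] at hG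
      exact hvar j b G hG p hp
    · rw [if_neg (by simpa using h)] at hG
      have hd' := ((nodeDepth_gate_le hgs hj h).mp hd).2
      have hw' := (nodeWeft_le hgs hj).mp hw
      have hlt := fun i hi => pred_lt hgs hj (i := i) hi
      by_cases hlarge : 2 < (gateAt gs j).preds.length
      · rw [if_pos (by simpa using hlarge)] at hG
        rw [if_pos hlarge] at hw'
        have hlow : ∀ i ∈ (gateAt gs j).preds, ∀ b', IsBoolean (xorPoly b' (nodePoly gs d i)) :=
          fun i hi b' => isBoolean_of_polyVal _ fun S => polyVal_xorPoly _
            (polyVal_nodePoly hgs S d i (hlt i hi) (hd' i hi) (hw'.2 i hi))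
        split_ifs at hG
        · rw [List.mem_singleton.mp hG] at hp
          obtain ⟨i, hi, rfl⟩ := List.mem_map.mp hp
          exact hlow i hi _
        · obtain ⟨i, hi, rfl⟩ := List.mem_map.mp hG
          rw [List.mem_singleton.mp hp]
          exact hlow i hi _
      · rw [if_neg (by simpa using hlarge)] at hG
        rw [if_neg hlarge] at hw'
        have hbr : ∀ (l : List ℕ), (∀ i ∈ l, i ∈ (gateAt gs j).preds) → ∀ (b' : Bool),
            ∀ G ∈ (if l.isEmpty then [[]] else guesses gs d (l.headD 0) b'), ∀ p ∈ G,
              IsBoolean p := by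
          intro l hl b' G hG
          cases l with
          | nil => rw [List.mem_singleton.mp hG]; simp
          | cons i l =>
            have hi := hl i List.mem_cons_self
            exact ih i b' (hlt i hi) (hd' i hi) (hw' i hi) G hG
        by_cases hbo : (b ^^ (gateAt gs j).negOut) = true
        · rw [if_pos hbo] at hG
          obtain ⟨G1, hG1, hG⟩ := List.mem_flatMap.mp hG
          obtain ⟨G2, hG2, rfl⟩ := List.mem_map.mp hG
          exact (List.mem_append.mp hp).elim (hbr _ (fun _ hi => hi) _ G1 hG1 p)
            (hbr _ (fun _ hi => List.mem_of_mem_tail hi) _ G2 hG2 p)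
        · rw [if_neg hbo] at hG
          obtain ⟨i, hi, hG⟩ := List.mem_flatMap.mp hG
          exact ih i _ (hlt i hi) (hd' i hi) (hw' i hi) G hG p hp

theorem polyVal_eq_one_iff {S : Finset ℕ} {p : SPoly} {v : Bool}
    (h : polyVal S p = if v then 1 else 0) : polyVal S p = 1 ↔ v = true := by
  rw [h]
  cases v <;> simp

/-- Viewed as a conjunction, a large gate has inputs of weft zero: its truth is one conjunction of
constraints, its falsity a choice of one failing input. A small gate combines guesses for at most
two inputs, by pairing them for truth and by union for falsity. -/
theorem exists_guess_iff {gs : List Gate} (hgs : Ordered gs) (S : Finset ℕ) (d : ℕ) :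
    ∀ j b, j < gs.length → nodeDepth gs j ≤ d → nodeWeft gs j ≤ 1 →
      ((∃ G ∈ guesses gs d j b, ∀ p ∈ G, polyVal S p = 1) ↔ nodeVal gs S j = b) := by
  have hvar : ∀ (j : ℕ) (b : Bool), j < gs.length → (gateAt gs j).tag = 0 →
      ((∃ G ∈ [[xorPoly (!b) [(true, [(gateAt gs j).var])]]], ∀ p ∈ G, polyVal S p = 1) ↔
        nodeVal gs S j = b) := by
    intro j b hj h
    simp only [List.mem_singleton, exists_eq_left, forall_eq]
    rw [polyVal_eq_one_iff (polyVal_xorPoly _ (polyVal_var S _)), nodeVal_inp hgs hj S h]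
    cases b <;> simp
  induction d with
  | zero =>
    intro j b hj hd _
    have h : (gateAt gs j).tag = 0 := by
      by_contra h
      exact absurd ((nodeDepth_gate_le hgs hj h).mp hd).1 (by omega)
    rw [guesses, if_pos (by simpa using h)]
    exact hvar j b hj h
  | succ d ih =>
    intro j b hj hd hw
    rw [guesses]
    by_cases h : (gateAt gs j).tag = 0
    · rw [if_pos (by simpa using h)]
      exact hvar j b hj h
    · rw [if_neg (by simpa using h), nodeVal_gate hgs hj S h]
      have hd' := ((nodeDepth_gate_le hgs hj h).mp hd).2
      have hw' := (nodeWeft_le hgs hj).mp hw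
      have hlt := fun i hi => pred_lt hgs hj (i := i) hi
      -- The output negation is moved into the target value, so only the inner conjunction has to be
      -- guessed.
      have hb : ∀ x : Bool, (((gateAt gs j).negOut ^^ x) = b ↔ x = (b ^^ (gateAt gs j).negOut)) := by
        intro x
        cases x <;> cases b <;> cases (gateAt gs j).negOut <;> simp
      rw [hb]
      by_cases hlarge : 2 < (gateAt gs j).preds.length
      · rw [if_pos (by simpa using hlarge)]
        rw [if_pos hlarge] at hw'
        have hlow : ∀ i ∈ (gateAt gs j).preds, ∀ b', (polyVal S (xorPoly b' (nodePoly gs d i)) = 1 ↔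
            (b' ^^ nodeVal gs S i) = true) :=
          fun i hi b' => polyVal_eq_one_iff (polyVal_xorPoly _
            (polyVal_nodePoly hgs S d i (hlt i hi) (hd' i hi) (hw'.2 i hi)))
        cases hbo : (b ^^ (gateAt gs j).negOut)
        · rw [if_neg (by simp), List.all_eq_false]
          simp only [List.mem_map, exists_exists_and_eq_and, List.mem_singleton, forall_eq]
          refine exists_congr fun i => and_congr_right fun hi => ?_
          rw [hlow i hi]
          cases (gateAt gs j).negIn <;> simp
        · rw [if_pos rfl, List.all_eq_true]
          simp only [List.mem_singleton, exists_eq_left, List.mem_map, forall_exists_index, and_imp,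
            forall_apply_eq_imp_iff₂]
          exact forall₂_congr fun i hi => hlow i hi _
      · rw [if_neg (by simpa using hlarge)]
        rw [if_neg hlarge] at hw'
        -- A missing input contributes one empty conjunction, which always holds. The lemma is
        -- applied to `preds` and to its tail, covering fan-in zero, one and two uniformly.
        have hbr : ∀ (l : List ℕ), (∀ i ∈ l, i ∈ (gateAt gs j).preds) → ∀ (b' : Bool),
            ((∃ G ∈ (if l.isEmpty then [[]] else guesses gs d (l.headD 0) b'), ∀ p ∈ G,
              polyVal S p = 1) ↔ ∀ i ∈ l.take 1, nodeVal gs S i = b') := by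
          intro l hl b'
          cases l with
          | nil => simp
          | cons i l =>
            have hi := hl i List.mem_cons_self
            rw [if_neg (by simp), List.headD_cons, ih i b' (hlt i hi) (hd' i hi) (hw' i hi)]
            simp
        cases hbo : (b ^^ (gateAt gs j).negOut)
        · rw [if_neg (by simp), List.all_eq_false]
          simp only [List.mem_flatMap]
          have : ∀ i ∈ (gateAt gs j).preds, ((∃ G ∈ guesses gs d i (gateAt gs j).negIn,
              ∀ p ∈ G, polyVal S p = 1) ↔ ¬ ((gateAt gs j).negIn ^^ nodeVal gs S i) = true) := by
            intro i hi
            rw [ih i _ (hlt i hi) (hd' i hi) (hw' i hi)]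
            cases (gateAt gs j).negIn <;> simp
          constructor
          · rintro ⟨G, ⟨i, hi, hG⟩, hp⟩
            exact ⟨i, hi, (this i hi).mp ⟨G, hG, hp⟩⟩
          · rintro ⟨i, hi, hv⟩
            obtain ⟨G, hG, hp⟩ := (this i hi).mpr hv
            exact ⟨G, ⟨i, hi, hG⟩, hp⟩
        · have h1 := hbr _ (fun _ hi => hi) (!(gateAt gs j).negIn)
          have h2 := hbr _ (fun _ hi => List.mem_of_mem_tail hi) (!(gateAt gs j).negIn)
          have h3 : ((∀ i ∈ (gateAt gs j).preds.take 1, nodeVal gs S i = !(gateAt gs j).negIn) ∧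
              ∀ i ∈ (gateAt gs j).preds.tail.take 1, nodeVal gs S i = !(gateAt gs j).negIn) ↔
              ((gateAt gs j).preds.all fun i => (gateAt gs j).negIn ^^ nodeVal gs S i) = true := by
            have hx : ∀ i, nodeVal gs S i = (!(gateAt gs j).negIn) ↔
                ((gateAt gs j).negIn ^^ nodeVal gs S i) = true := by
              intro i
              cases (gateAt gs j).negIn <;> simp
            simp only [hx]
            match hl : (gateAt gs j).preds with
            | [] => simp
            | [a] => simp
            | [a, a'] => simp
            | a :: a' :: e :: l =>
              rw [hl] at hlarge
              simp at hlarge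
          rw [if_pos rfl, ← h3, ← h1, ← h2]
          simp only [List.mem_flatMap, List.mem_map]
          constructor
          · rintro ⟨_, ⟨G1, hG1, G2, hG2, rfl⟩, hp⟩
            exact ⟨⟨G1, hG1, fun p h => hp p (List.mem_append_left _ h)⟩,
              ⟨G2, hG2, fun p h => hp p (List.mem_append_right _ h)⟩⟩
          · rintro ⟨⟨G1, hG1, hp1⟩, ⟨G2, hG2, hp2⟩⟩
            exact ⟨_, ⟨G1, hG1, G2, hG2, rfl⟩, fun p h =>
              (List.mem_append.mp h).elim (hp1 p) (hp2 p)⟩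

/-! ### Coding of circuits -/

theorem Gate.enc_injective : Function.Injective Gate.enc := by
  have hlist : Function.Injective fun js : List ℕ => SExp.list (js.map SExp.num) :=
    SExp.list_injective.comp (List.map_injective_iff.mpr SExp.num_injective)
  intro g g' h
  cases g <;> cases g' <;>
    simp [Gate.enc, SExp.num_injective.eq_iff] at h
  · rw [h]
  · rw [h]
  · rw [hlist h]
  · rw [hlist h]

instance : Enc Gate := ⟨Gate.enc, Gate.enc_injective⟩

theorem Circuit.enc_eq (C : Circuit) : C.enc = Enc.enc (C.inputs, C.gates) := rfl

instance : Enc Circuit := ⟨Circuit.enc, fun C C' h => by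
  rw [Circuit.enc_eq, Circuit.enc_eq] at h
  have := Enc.enc_injective h
  simp only [Prod.mk.injEq] at this
  cases C
  cases C'
  simp_all⟩

/-- The list with a given code. -/
def SExp.toList : SExp → List SExp
  | nil => []
  | cons a l => a :: l.toList

/-- Every tree is the code of a list, read along its right spine. Hence decoding a list leaves the
word unchanged and costs no computation. -/
theorem SExp.list_toList (x : SExp) : SExp.list x.toList = x := by
  induction x with
  | nil => rfl
  | cons a l _ ih => rw [toList, list, ih]

theorem SExp.toList_list (l : List SExp) : (SExp.list l).toList = l :=
  SExp.list_injective (SExp.list_toList _)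

/-- The number with a given code. -/
def decodeNat (x : SExp) : ℕ := x.toList.length

theorem decodeNat_num (n : ℕ) : decodeNat (SExp.num n) = n := by
  induction n with
  | zero => rfl
  | succ n ih => simpa [decodeNat, SExp.num, SExp.toList] using ih

theorem map_decodeNat (js : List ℕ) :
    ((SExp.list (js.map SExp.num)).toList.map decodeNat) = js := by
  rw [SExp.toList_list, List.map_map]
  conv_rhs => rw [← List.map_id js]
  exact List.map_congr_left fun j _ => decodeNat_num j

/-- The node with a given code. -/
def decodeGate (x : SExp) : Gate :=
  if decide (x.hd = SExp.num 0) then Gate.inp (decodeNat x.tl)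
  else if decide (x.hd = SExp.num 1) then Gate.not (decodeNat x.tl)
  else if decide (x.hd = SExp.num 2) then Gate.and (x.tl.toList.map decodeNat)
  else Gate.or (x.tl.toList.map decodeNat)

/-- Only a left inverse: `decodeGate` accepts every tree, with `or` as fallback, so the reduction
detects invalid codes by encoding again. -/
theorem decodeGate_enc (g : Gate) : decodeGate g.enc = g := by
  cases g <;> simp [decodeGate, Gate.enc, SExp.hd, SExp.tl, SExp.num_injective.eq_iff,
    decodeNat_num, map_decodeNat]

/-- The circuit with a given code. -/
def decodeCircuit (x : SExp) : Circuit := ⟨decodeNat x.hd, x.tl.toList.map decodeGate⟩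

theorem decodeCircuit_enc (C : Circuit) : decodeCircuit C.enc = C := by
  obtain ⟨n, gs⟩ := C
  simp only [decodeCircuit, Circuit.enc, SExp.hd, SExp.tl, decodeNat_num, SExp.toList_list,
    List.map_map, Circuit.mk.injEq, true_and]
  conv_rhs => rw [← List.map_id gs]
  exact List.map_congr_left fun g _ => decodeGate_enc g

/-! ### The reduction -/

/-- The instance of Critical Node Cut for a circuit. -/
def cutInstance (h : ℕ) (C : Circuit) (k : ℕ) : SExp × ℕ :=
  let F := guesses C.gates h (C.gates.length - 1) true
  let H := choiceSets C.inputs (2 ^ h) F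
  let c := C.inputs + F.length + (k + 3)
  let N := c + H.length - (k + 1 + choiceBound C.inputs (2 ^ h) k F)
  (enc (c + H.length, cliqueEdges c H, N * (N - 1)), k + 1)

/-- The reduction from weighted satisfiability of circuits of weft one and depth `h` to
Critical Node Cut; invalid inputs are mapped to a word that does not encode a graph. -/
def cutReduction (h : ℕ) (a : SExp × ℕ) : SExp × ℕ :=
  if decide ((decodeCircuit a.1).enc = a.1) && (isWellFormed (decodeCircuit a.1) &&
    smallNode (decodeCircuit a.1).gates h 1 ((decodeCircuit a.1).gates.length - 1))
  then cutInstance h (decodeCircuit a.1) a.2 else (SExp.nil, 0)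

theorem cutInstance_mem_iff {h : ℕ} {C : Circuit} (hC : C.WellFormed) (hw : C.weft ≤ 1)
    (hd : C.depth ≤ h) (k : ℕ) : cutInstance h C k ∈ criticalNodeCut ↔
      ∃ S : Finset ℕ, S ⊆ Finset.range C.inputs ∧ S.card = k ∧ C.eval S = true := by
  set F := guesses C.gates h (C.gates.length - 1) true with hF
  set H := choiceSets C.inputs (2 ^ h) F with hH
  -- The `k + 3` spare clique vertices lie in no list; they ensure that a cut of size `k + 1` leaves
  -- two clique vertices.
  set c := C.inputs + F.length + (k + 3) with hc
  have hord : Circuit.Ordered C.gates := hC.2.1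
  have hlast : C.gates.length - 1 < C.gates.length := by
    have := List.length_pos_iff.mpr hC.1
    omega
  rw [Circuit.weft_eq] at hw
  rw [Circuit.depth_eq] at hd
  have hpow : 1 ≤ 2 ^ h := Nat.one_le_two_pow
  have hF1 : ∀ G ∈ F, ∀ p ∈ G, ∀ m ∈ p, m.2.length ≤ 2 ^ h ∧ ∀ u ∈ m.2, u < C.inputs :=
    fun G hG p hp m hm => ⟨(guesses_polyIn _ _ _ _ G hG p hp m hm).1,
      fun u hu => hC.2.2 u ((guesses_polyIn _ _ _ _ G hG p hp m hm).2 u hu)⟩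
  have hF2 : ∀ G ∈ F, ∀ p ∈ G, IsBoolean p := guesses_isBoolean hord h _ _ hlast hd hw
  have hF3 := fun S => exists_guess_iff hord S h _ true hlast hd hw
  have hHlt : ∀ T ∈ H, ∀ u ∈ T, u < c := fun T hT u hu => by
    have := lt_of_mem_choiceSets hF1 hpow T hT u hu
    omega
  rw [cutInstance, mem_criticalNodeCut_iff _ _ (cliqueEdges_lt hHlt)]
  constructor
  · intro hcut
    obtain ⟨S, hS, hin⟩ := inside_of_hasCriticalNodeCut hHlt (by omega) rfl hcut
    obtain ⟨S', hS', hk, hG⟩ := exists_choice_of_inside hF2 hF1 hpow hS hin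
    refine ⟨S', hS', hk, ?_⟩
    rw [Circuit.eval_eq]
    exact (hF3 S').mp hG
  · rintro ⟨S', hS', rfl, heval⟩
    rw [Circuit.eval_eq] at heval
    obtain ⟨G, hG, hp⟩ := (hF3 S').mpr heval
    obtain ⟨S, hS, hcard, hin⟩ := exists_inside_of_choice hF1 hpow hS' hG hp
    rw [← hcard]
    exact hasCriticalNodeCut_of_inside hHlt
      (hS.trans (Finset.range_subset_range.mpr (by omega))) rfl hin

theorem cutReduction_mem_iff (h : ℕ) (a : SExp × ℕ) :
    a ∈ weightedCircuitSat 1 h ↔ cutReduction h a ∈ criticalNodeCut := by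
  obtain ⟨x, k⟩ := a
  rw [cutReduction]
  have hsmall : ∀ C : Circuit, C.WellFormed →
      (smallNode C.gates h 1 (C.gates.length - 1) = true ↔ C.depth ≤ h ∧ C.weft ≤ 1) := by
    intro C hC
    have := List.length_pos_iff.mpr hC.1
    rw [smallNode_iff hC.2.1 _ _ _ (by omega), Circuit.depth_eq, Circuit.weft_eq]
  split_ifs with hx
  · simp only [Bool.and_eq_true, decide_eq_true_eq, isWellFormed_iff] at hx
    obtain ⟨hx, hwf, hs⟩ := hx
    obtain ⟨hd, hw⟩ := (hsmall _ hwf).mp hs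
    rw [cutInstance_mem_iff hwf hw hd]
    constructor
    · rintro ⟨C, _, _, _, hCx, hS⟩
      have : decodeCircuit x = C := by
        rw [show x = C.enc from hCx, decodeCircuit_enc]
      rwa [this]
    · intro hS
      exact ⟨_, hwf, hw, hd, hx.symm, hS⟩
  · constructor
    · rintro ⟨C, hwf, hw, hd, hCx, -⟩
      have hCx : x = C.enc := hCx
      -- A yes-instance is the code of a valid circuit and would have passed every test.
      refine absurd ?_ hx
      simp only [hCx, decodeCircuit_enc, Bool.and_eq_true, decide_eq_true_eq, isWellFormed_iff,
        true_and]
      exact ⟨hwf, (hsmall C hwf).mpr ⟨hd, hw⟩⟩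
    · rintro ⟨n, G, E, y, _, hnil, _⟩
      simp [encGraph] at hnil

/-! ### The reduction takes polynomial time -/

namespace PolyTime

variable {α β γ : Type} [Enc α] [Enc β] [Enc γ]

theorem toList {f : α → SExp} (hf : PolyTime f) : PolyTime fun a => (f a).toList :=
  hf.recode (fun a => a) (fun _ => rfl) fun a => by
    change SExp.list ((f a).toList.map fun x => x) = f a
    rw [List.map_id', SExp.list_toList]

theorem decodeNat {f : α → SExp} (hf : PolyTime f) : PolyTime fun a => decodeNat (f a) :=
  hf.toList.length

theorem gate {t : ℕ} {f : α → SExp} (hf : PolyTime f) {g : α → Gate}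
    (hg : ∀ a, (g a).enc = SExp.cons (SExp.num t) (f a)) : PolyTime g :=
  ((const t).pair hf).recode (fun a => a) (fun _ => rfl) hg

theorem decodeNats {f : α → SExp} (hf : PolyTime f) :
    PolyTime fun a => (f a).toList.map ParamComplexity.decodeNat :=
  map (g := fun _ x => ParamComplexity.decodeNat x) hf.toList snd.decodeNat

theorem decodeGate {f : α → SExp} (hf : PolyTime f) : PolyTime fun a => decodeGate (f a) := by
  have hhd := sexpHd.comp hf
  have htl := sexpTl.comp hf
  exact (hhd.eq (const _)).cond (gate htl.decodeNat.toSExp fun _ => rfl)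
    ((hhd.eq (const _)).cond (gate htl.decodeNat.toSExp fun _ => rfl)
      ((hhd.eq (const _)).cond (gate htl.decodeNats.toSExp fun _ => rfl)
        (gate htl.decodeNats.toSExp fun _ => rfl)))

theorem circuit_mk {f : α → ℕ} {g : α → List Gate} (hf : PolyTime f) (hg : PolyTime g) :
    PolyTime fun a => Circuit.mk (f a) (g a) :=
  (hf.pair hg).recode (fun a => a) (fun _ => rfl) fun _ => rfl

theorem inputs {f : α → Circuit} (hf : PolyTime f) : PolyTime fun a => (f a).inputs :=
  (fst (α := ℕ) (β := List Gate)).comp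
    (hf.recode (g := fun a => ((f a).inputs, (f a).gates)) (fun a => a) (fun _ => rfl) fun _ => rfl)

theorem gates {f : α → Circuit} (hf : PolyTime f) : PolyTime fun a => (f a).gates :=
  (snd (α := ℕ) (β := List Gate)).comp
    (hf.recode (g := fun a => ((f a).inputs, (f a).gates)) (fun a => a) (fun _ => rfl) fun _ => rfl)

theorem decodeCircuit {f : α → SExp} (hf : PolyTime f) : PolyTime fun a => decodeCircuit (f a) :=
  circuit_mk (sexpHd.comp hf).decodeNat
    (map (g := fun _ x => ParamComplexity.decodeGate x) (sexpTl.comp hf).toList snd.decodeGate)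

theorem tag {f : α → Gate} (hf : PolyTime f) : PolyTime fun a => (f a).tag :=
  of_enc ((sexpHd.comp hf.toSExp).ofEq fun a => by cases f a <;> rfl)

theorem var {f : α → Gate} (hf : PolyTime f) : PolyTime fun a => (f a).var :=
  of_enc (((hf.tag.eq (const 0)).cond (sexpTl.comp hf.toSExp) (const SExp.nil)).ofEq
    fun a => by cases f a <;> rfl)

theorem preds {f : α → Gate} (hf : PolyTime f) : PolyTime fun a => (f a).preds :=
  of_enc (((hf.tag.eq (const 0)).cond (const SExp.nil) ((hf.tag.eq (const 1)).cond
    (sexpTl.comp hf.toSExp).singleton.toSExp (sexpTl.comp hf.toSExp))).ofEq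
      fun a => by cases f a <;> rfl)

theorem negIn {f : α → Gate} (hf : PolyTime f) : PolyTime fun a => (f a).negIn :=
  hf.tag.eq (const 3)

theorem negOut {f : α → Gate} (hf : PolyTime f) : PolyTime fun a => (f a).negOut :=
  (hf.tag.eq (const 2)).not

theorem gateAt {f : α → List Gate} {g : α → ℕ} (hf : PolyTime f) (hg : PolyTime g) :
    PolyTime fun a => gateAt (f a) (g a) :=
  hf.getD hg _

/-- The induction on `d` builds a separate program for each depth, so a fixed nesting of list
operations suffices. -/
theorem smallNode_aux (d : ℕ) :
    PolyTime fun a : List Gate × ℕ × ℕ => smallNode a.1 d a.2.1 a.2.2 := by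
  have hg : PolyTime fun a : List Gate × ℕ × ℕ => ParamComplexity.gateAt a.1 a.2.2 :=
    gateAt fst (snd.comp snd)
  induction d with
  | zero => exact hg.tag.eq (const 0)
  | succ d ih =>
    exact (hg.tag.eq (const 0)).cond (const true) (((const 2).lt hg.preds.length).cond
      (((const 0).lt (fst.comp snd)).and
        (all (p := fun (a : List Gate × ℕ × ℕ) i => smallNode a.1 d (a.2.1 - 1) i) hg.preds
          (ih.comp ((fst.comp fst).pair (((fst.comp (snd.comp fst)).sub (const 1)).pair snd)))))
      (all (p := fun (a : List Gate × ℕ × ℕ) i => smallNode a.1 d a.2.1 i) hg.preds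
          (ih.comp ((fst.comp fst).pair ((fst.comp (snd.comp fst)).pair snd)))))

theorem isWellFormed {f : α → Circuit} (hf : PolyTime f) : PolyTime fun a => isWellFormed (f a) :=
  hf.gates.isEmpty.not.and ((all (p := fun a i => (ParamComplexity.gateAt (f a).gates i).preds.all
      fun j => decide (j < i)) hf.gates.length.range
    (all (p := fun (b : α × ℕ) j => decide (j < b.2))
      (gateAt (hf.comp fst).gates snd).preds (snd.lt (snd.comp fst)))).and
    (all (p := fun a g => !decide (g.tag = 0) || decide (g.var < (f a).inputs)) hf.gates
      ((snd.tag.eq (const 0)).not.or (snd.var.lt (hf.comp fst).inputs))))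

theorem complPoly {f : α → SPoly} (hf : PolyTime f) : PolyTime fun a => complPoly (f a) :=
  (const (true, [])).list_cons (map (g := fun _ (m : Bool × List ℕ) => (!m.1, m.2)) hf
    ((fst.comp snd).not.pair (snd.comp snd)))

theorem mulPoly {f g : α → SPoly} (hf : PolyTime f) (hg : PolyTime g) :
    PolyTime fun a => mulPoly (f a) (g a) :=
  flatMap (g := fun a (m : Bool × List ℕ) => (g a).map fun m' => (!(m.1 ^^ m'.1), m.2 ++ m'.2)) hf
    (map (g := fun (b : α × Bool × List ℕ) (m' : Bool × List ℕ) =>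
      (!(b.2.1 ^^ m'.1), b.2.2 ++ m'.2)) (hg.comp fst)
      (((fst.comp (snd.comp fst)).xor (fst.comp snd)).not.pair
        ((snd.comp (snd.comp fst)).append (snd.comp snd))))

theorem xorPoly {b : α → Bool} {f : α → SPoly} (hb : PolyTime b) (hf : PolyTime f) :
    PolyTime fun a => xorPoly (b a) (f a) :=
  hb.cond hf.complPoly hf

theorem varPoly {f : α → ℕ} (hf : PolyTime f) : PolyTime fun a => ([(true, [f a])] : SPoly) :=
  ((const true).pair hf.singleton).singleton

theorem nodePoly_aux (d : ℕ) : PolyTime fun a : List Gate × ℕ => nodePoly a.1 d a.2 := by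
  have hg : PolyTime fun a : List Gate × ℕ => ParamComplexity.gateAt a.1 a.2 := gateAt fst snd
  induction d with
  | zero => exact (hg.tag.eq (const 0)).cond hg.var.varPoly (const [])
  | succ d ih =>
    exact (hg.tag.eq (const 0)).cond hg.var.varPoly (xorPoly hg.negOut (mulPoly
      (hg.preds.isEmpty.cond (const [(true, [])])
        (xorPoly hg.negIn (ih.comp (fst.pair (hg.preds.headD 0)))))
      (hg.preds.tail.isEmpty.cond (const [(true, [])])
        (xorPoly hg.negIn (ih.comp (fst.pair (hg.preds.tail.headD 0)))))))

/-- A small gate may multiply the numbers of guesses of its inputs, but only boundedly often because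
`d` is fixed, so the family stays polynomial. -/
theorem guesses_aux (d : ℕ) :
    PolyTime fun a : List Gate × ℕ × Bool => guesses a.1 d a.2.1 a.2.2 := by
  have hg : PolyTime fun a : List Gate × ℕ × Bool => ParamComplexity.gateAt a.1 a.2.1 :=
    gateAt fst (fst.comp snd)
  have hb : PolyTime fun a : List Gate × ℕ × Bool => a.2.2 := snd.comp snd
  have hvar := (xorPoly hb.not hg.var.varPoly).singleton.singleton
  induction d with
  | zero => exact (hg.tag.eq (const 0)).cond hvar (const [])
  | succ d ih =>
    have hnode : PolyTime fun q : (List Gate × ℕ × Bool) × ℕ => nodePoly q.1.1 d q.2 :=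
      (nodePoly_aux d).comp ((fst.comp fst).pair snd)
    have hneg : PolyTime fun q : (List Gate × ℕ × Bool) × ℕ =>
        (ParamComplexity.gateAt q.1.1 q.1.2.1).negIn := hg.negIn.comp fst
    have hb1 : PolyTime fun a : List Gate × ℕ × Bool =>
        if (ParamComplexity.gateAt a.1 a.2.1).preds.isEmpty then ([[]] : List (List SPoly))
          else guesses a.1 d ((ParamComplexity.gateAt a.1 a.2.1).preds.headD 0)
            (!(ParamComplexity.gateAt a.1 a.2.1).negIn) :=
      hg.preds.isEmpty.cond (const [[]])
        (ih.comp (fst.pair ((hg.preds.headD 0).pair hg.negIn.not)))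
    have hb2 : PolyTime fun a : List Gate × ℕ × Bool =>
        if (ParamComplexity.gateAt a.1 a.2.1).preds.tail.isEmpty then ([[]] : List (List SPoly))
          else guesses a.1 d ((ParamComplexity.gateAt a.1 a.2.1).preds.tail.headD 0)
            (!(ParamComplexity.gateAt a.1 a.2.1).negIn) :=
      hg.preds.tail.isEmpty.cond (const [[]])
        (ih.comp (fst.pair ((hg.preds.tail.headD 0).pair hg.negIn.not)))
    exact (hg.tag.eq (const 0)).cond hvar (((const 2).lt hg.preds.length).cond
      ((hb.xor hg.negOut).cond
        (map (g := fun (a : List Gate × ℕ × Bool) i => ParamComplexity.xorPoly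
          (ParamComplexity.gateAt a.1 a.2.1).negIn (nodePoly a.1 d i)) hg.preds
          (xorPoly hneg hnode)).singleton
        (map (g := fun (a : List Gate × ℕ × Bool) i => [ParamComplexity.xorPoly
          (!(ParamComplexity.gateAt a.1 a.2.1).negIn) (nodePoly a.1 d i)]) hg.preds
          (xorPoly hneg.not hnode).singleton))
      ((hb.xor hg.negOut).cond
        (flatMap (g := fun (a : List Gate × ℕ × Bool) G =>
          (if (ParamComplexity.gateAt a.1 a.2.1).preds.tail.isEmpty then ([[]] : List (List SPoly))
            else guesses a.1 d ((ParamComplexity.gateAt a.1 a.2.1).preds.tail.headD 0)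
              (!(ParamComplexity.gateAt a.1 a.2.1).negIn)).map fun G' => G ++ G') hb1
          (map (g := fun (q : (List Gate × ℕ × Bool) × List SPoly) G' => q.2 ++ G') (hb2.comp fst)
            ((snd.comp fst).append snd)))
        (flatMap (g := fun (a : List Gate × ℕ × Bool) i =>
          guesses a.1 d i (ParamComplexity.gateAt a.1 a.2.1).negIn) hg.preds
          (ih.comp ((fst.comp fst).pair (snd.pair hneg))))))

theorem tuples {f : α → List ℕ} (hf : PolyTime f) (D : ℕ) : PolyTime fun a => tuples (f a) D := by
  induction D with
  | zero => exact const [[]]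
  | succ D ih =>
    exact (const []).list_cons (flatMap
      (g := fun a u => (ParamComplexity.tuples (f a) D).map fun T => u :: T) hf
      (map (g := fun (q : α × ℕ) T => q.2 :: T) (ih.comp fst) ((snd.comp fst).list_cons snd)))

theorem tupleCount {f : α → ℕ} (hf : PolyTime f) (D : ℕ) :
    PolyTime fun a => tupleCount (f a) D := by
  induction D with
  | zero => exact const 1
  | succ D ih => exact (const 1).add (hf.mul ih)

theorem positivize {U : α → List ℕ} {M : α → SPoly} (hU : PolyTime U) (hM : PolyTime M) (D : ℕ) :
    PolyTime fun a => positivize (U a) D (M a) :=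
  (flatMap (g := fun a (m : Bool × List ℕ) => if m.1 then [m.2]
      else (ParamComplexity.tuples (U a) D).filter fun T => !decide (T = m.2)) hM
    ((fst.comp snd).cond (snd.comp snd).singleton
      (filter (p := fun (q : α × Bool × List ℕ) T => !decide (T = q.2.2))
        ((hU.tuples D).comp fst) (snd.eq (snd.comp (snd.comp fst))).not))).append (hU.tuples D)

theorem negCount {M : α → SPoly} (hM : PolyTime M) : PolyTime fun a => negCount (M a) :=
  (filter (p := fun _ (m : Bool × List ℕ) => !m.1) hM (fst.comp snd).not).length.ofEq fun _ =>
    List.countP_eq_length_filter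

theorem choicePoly {n : α → ℕ} {F : α → List (List SPoly)} (hn : PolyTime n) (hF : PolyTime F) :
    PolyTime fun a => choicePoly (n a) (F a) := by
  have hrange := hF.length.range
  have hvar : PolyTime fun q : α × ℕ => n q.1 + q.2 := (hn.comp fst).add snd
  refine append (flatMap (g := fun a i => ((F a).getD i []).flatMap fun p =>
    (p ++ [(false, [])]).map fun m => (m.1, (n a + i) :: m.2)) hrange ?_)
    (append (flatMap (g := fun a i => [(true, [n a + i]), (true, [n a + i])]) hrange ?_)
      (flatMap (g := fun a i => (List.range (F a).length).map
        fun j => (false, [n a + i, n a + j])) hrange ?_))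
  · refine flatMap (g := fun (q : α × ℕ) (p : SPoly) =>
      (p ++ [(false, [])]).map fun m : Bool × List ℕ => (m.1, (n q.1 + q.2) :: m.2))
      ((hF.comp fst).getD snd []) ?_
    exact map (g := fun (r : (α × ℕ) × SPoly) (m : Bool × List ℕ) =>
      (m.1, (n r.1.1 + r.1.2) :: m.2)) (snd.append (const [(false, [])]))
      ((fst.comp snd).pair ((hvar.comp (fst.comp fst)).list_cons (snd.comp snd)))
  · exact ((const true).pair hvar.singleton).list_cons ((const true).pair hvar.singleton).singleton
  · refine map (g := fun (q : α × ℕ) j => (false, [n q.1 + q.2, n q.1 + j])) (hrange.comp fst) ?_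
    exact (const false).pair ((hvar.comp fst).list_cons
      ((hn.comp (fst.comp fst)).add snd).singleton)

theorem cliqueEdges {c : α → ℕ} {H : α → List (List ℕ)} (hc : PolyTime c) (hH : PolyTime H) :
    PolyTime fun a => cliqueEdges (c a) (H a) := by
  refine append (flatMap (g := fun a u => ((List.range (c a)).filter
    fun v => !decide (u = v)).map fun v => (u, v)) hc.range ?_)
    (flatMap (g := fun a i => ((H a).getD i []).map fun u => (u, c a + i)) hH.length.range ?_)
  · refine map (g := fun (q : α × ℕ) v => (q.2, v)) (filter (p := fun (q : α × ℕ) v =>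
      !decide (q.2 = v)) (hc.comp fst).range ?_) ((snd.comp fst).pair snd)
    exact ((snd.comp fst).eq snd).not
  · exact map (g := fun (q : α × ℕ) u => (u, c q.1 + q.2)) ((hH.comp fst).getD snd [])
      (snd.pair ((hc.comp (fst.comp fst)).add (snd.comp fst)))

/-- The tuple length `2 ^ h + 1` is constant, so listing all tuples is polynomial. The weight `k` is
part of the input in unary, so the `k + 3` spare vertices are affordable. -/
theorem cutInstance (h : ℕ) {C : α → Circuit} {k : α → ℕ} (hC : PolyTime C) (hk : PolyTime k) :
    PolyTime fun a => cutInstance h (C a) (k a) := by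
  have hF : PolyTime fun a => guesses (C a).gates h ((C a).gates.length - 1) true :=
    (guesses_aux h).comp (hC.gates.pair ((hC.gates.length.sub (const 1)).pair (const true)))
  have hM := hC.inputs.choicePoly hF
  have hH : PolyTime fun a => choiceSets (C a).inputs (2 ^ h)
      (guesses (C a).gates h ((C a).gates.length - 1) true) :=
    (hC.inputs.add hF.length).range.positivize hM (2 ^ h + 1)
  have hB : PolyTime fun a => choiceBound (C a).inputs (2 ^ h) (k a)
      (guesses (C a).gates h ((C a).gates.length - 1) true) :=
    (const 1).add ((hM.negCount.add (const 1)).mul ((hk.add (const 1)).tupleCount (2 ^ h + 1)))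
  have hc := (hC.inputs.add hF.length).add (hk.add (const 3))
  have hN := (hc.add hH.length).sub ((hk.add (const 1)).add hB)
  exact (((hc.add hH.length).pair ((hc.cliqueEdges hH).pair
    (hN.mul (hN.sub (const 1))))).toSExp).pair (hk.add (const 1))

theorem cutReduction (h : ℕ) : PolyTime (cutReduction h) := by
  have hC : PolyTime fun a : SExp × ℕ => ParamComplexity.decodeCircuit a.1 := fst.decodeCircuit
  exact ((hC.toSExp.eq fst).and (hC.isWellFormed.and ((smallNode_aux h).comp
    (hC.gates.pair ((const 1).pair (hC.gates.length.sub (const 1))))))).cond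
    (hC.cutInstance h snd) (const (SExp.nil, 0))

end PolyTime

theorem cutReduction_snd_le (h : ℕ) (a : SExp × ℕ) : (cutReduction h a).2 ≤ a.2 + 1 := by
  rw [cutReduction]
  split_ifs
  · exact le_rfl
  · exact Nat.zero_le _

end ParamComplexity

/-- Critical Node Cut is `W[1]`-hard with respect to the cut size `k`. -/
theorem mainTheorem2 : ParamComplexity.W1Hard ParamComplexity.criticalNodeCut := by
  rintro A ⟨h, hA⟩
  exact hA.trans_polyTime (ParamComplexity.PolyTime.cutReduction h)
    (ParamComplexity.cutReduction_snd_le h) (ParamComplexity.cutReduction_mem_iff h)
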